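/- **Theorem (Existence of a feasible lifted trajectory).** Let $T>0$, let $f:\mathbb R^n\times\mathbb R^m\to\mathbb R^n$ be $C^2$, and let $x_0\in\mathbb R^n$. A *curve* is a pair $\xi=(x(\cdot),u(\cdot))$ with $x:[0,T]\to\mathbb R^n$ continuous and $u\in L_\infty([0,T];\mathbb R^m)$; curves carry the $L_\infty$ norm, and neighborhoods and local minimizers are understood in this norm. Let $\mathcal T$ be the set of curves with $\dot x(t)=f(x(t),u(t))$ for almost all $t\in[0,T]$ and $x(0)=x_0$, that is, $x(t)=x_0+\int_0^t f(x(s),u(s))\,ds$ for all $t$ (the *trajectories*). Let $p:\mathbb R^n\to\mathbb R^q$ select $q$ distinct coordinates of the state. *Weighted distances.* Let $Q,P_f\in\mathbb R^{n\times n}$, $R\in\mathbb R^{m\times m}$, $W\in\mathbb R^{q\times q}$ be symmetric positive definite and $W_1\in\mathbb R^{q\times q}$ symmetric positive semidefinite, and put (without square roots, $\|v\|_Q^2=v^TQv$) $$\|\xi-\xi_d\|_{L_2}=\tfrac12\int_0^T\big(\|x-x_d\|_Q^2+\|u-u_d\|_R^2\big)\,d\tau+\tfrac12\|x(T)-x_d(T)\|_{P_f}^2,\qquad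 \|\alpha\|_{L_2}=\int_0^T\alpha^TW\alpha\,dt+\alpha(T)^TW_1\alpha(T)$$ for curves $\xi,\xi_d$ and for output curves $\alpha:[0,T]\to\mathbb R^q$, respectively. *Feasibility region.* For $\rho\in[0,1]$ let $\overline{\mathcal{XU}}_\rho=\{(x,u): c_j(x,u;\rho)\le 0,\ j=1,\dots,N\}$, with interior $\mathcal{XU}_\rho$, where each $c_j(\cdot,\cdot;\rho)$ is $C^2$ and its derivatives of orders $0,1,2$ in $(x,u)$ are continuous in $(x,u,\rho)$ jointly; $\mathcal{XU}_\rho$ is nonempty and simply connected; $\mathcal{XU}_{\rho_2}\subseteq\mathcal{XU}_{\rho_1}$ for $0<\rho_1<\rho_2\le1$; and for every fixed $x$ the set $\{u:(x,u)\in\mathcal{XU}_\rho\}$ is convex. Assume that the nominal region $\overline{\mathcal{XU}}=\overline{\mathcal{XU}}_1$ is compact. *Barrier.* Fix an even integer $k\ge2$. For $\delta>0$ let $\beta_\delta(z)=-\log z$ for $z>\delta$ and $\beta_\delta(z)=\frac{k-1}{k}\Big[\Big(\frac{z-k\delta}{(k-1)\delta}\Big)^k-1\Big]-\log\delta$ for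 $z\le\delta$, and let $b_{\delta,\rho}(\xi)=\int_0^T\sum_j\beta_\delta\big(-c_j(x(\tau),u(\tau);\rho)\big)\,d\tau$. Let $\mathbf y_d:[0,T]\to\mathbb R^q$ be a desired output curve for which there is an exact lifted trajectory, i.e. $\xi_d=(x_d(\cdot),u_d(\cdot))\in\mathcal T$ with $p(x_d(t))=\mathbf y_d(t)$ for all $t\in[0,T]$, and suppose that for some $\rho_1\in[0,1]$ one has $(x_d(t),u_d(t))\in\mathcal{XU}_{\rho_1}$ for almost all $t$. Let $\delta_c>0$ be given, and consider the problem $$\min_{\xi\in\mathcal T}\ g_{\rho,\epsilon_c}(\xi),\qquad g_{\rho,\epsilon_c}(\xi)=\|\xi-\xi_d\|_{L_2}+\epsilon_c\,b_{\delta_c,\rho}(\xi).\tag{$*$}$$ An *isolated local minimizer* of $(*)$ is a $\xi^*\in\mathcal T$ for which there is $r>0$ such that $g_{\rho,\epsilon_c}(\xi^*)<g_{\rho,\epsilon_c}(\xi)$ for all $\xi\in\mathcal T$, $\xi\ne\xi^*$, at $L_\infty$ distance less than $r$ from $\xi^*$. Then: 1. There exist $\rho_0\in(0,1]$ and $\epsilon_{c0}>0$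 such that $(*)$ has an isolated local minimizer for all $0\le\rho<\rho_0$ and $0\le\epsilon_c<\epsilon_{c0}$. 2. If $\xi^*$ is an isolated local minimizer of $(*)$ for given $\rho\in(0,1]$ and $\epsilon_c>0$, then there exists $\epsilon_2>0$ such that $\|\xi^*-\xi_d\|_{L_2}\le\|\xi-\xi_d\|_{L_2}+\epsilon_2$ for all $\xi\in\mathcal T$ in a neighborhood of $\xi^*$. 3. For $\xi^*=(x^*(\cdot),u^*(\cdot))$ as in 2, there exists $\epsilon_3>0$ such that $\|p(x^*(\cdot))-\mathbf y_d(\cdot)\|_{L_2}\le\|p(x(\cdot))-\mathbf y_d(\cdot)\|_{L_2}+\epsilon_3$ for all $\xi=(x(\cdot),u(\cdot))\in\mathcal T$ in a neighborhood of $\xi^*$. -/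

import Mathlib

open MeasureTheory Set Topology
open scoped ENNReal

noncomputable section

namespace FeasTraj

/-- The Euclidean space `ℝᵈ`. -/
abbrev Vec (d : ℕ) : Type := EuclideanSpace ℝ (Fin d)

/-- Lebesgue measure on `[0, T]`. -/
abbrev leb (T : ℝ) : Measure (Icc (0 : ℝ) T) := Measure.comap Subtype.val volume

/-- State-input curves `ξ = (x(·), u(·))` on `[0, T]`: the state part is continuous, and the input
part is an (equivalence class of an) essentially bounded measurable function. The norm is the
`L_∞` norm. -/
abbrev Curve (T : ℝ) (n m : ℕ) : Type :=
  C(Icc (0 : ℝ) T, Vec n) × Lp (Vec m) ∞ (leb T)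

/-- The set of bounded trajectories of `ẋ = f(x, u)` through `x₀`: curves with
`x(t) = x₀ + ∫₀ᵗ f(x(s), u(s)) ds` for all `t ∈ [0, T]` (equivalently, `x` is absolutely continuous,
`x(0) = x₀`, and `ẋ(t) = f(x(t), u(t))` for almost all `t`). -/
def trajectories {T : ℝ} {n m : ℕ} (f : Vec n × Vec m → Vec n) (x₀ : Vec n) :
    Set (Curve T n m) :=
  {ξ | ∀ t : Icc (0 : ℝ) T, ξ.1 t = x₀ + ∫ s in Iic t, f (ξ.1 s, ξ.2 s) ∂(leb T)}

/-- The squared weighted norm `‖v‖²_Q = vᵀ Q v`. -/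
def wsq {d : ℕ} (Q : Matrix (Fin d) (Fin d) ℝ) (v : Vec d) : ℝ :=
  v.ofLp ⬝ᵥ Q.mulVec v.ofLp

/-- The final time, as a point of `[0, T]`. -/
def finalTime {T : ℝ} (hT : 0 < T) : Icc (0 : ℝ) T := ⟨T, hT.le, le_rfl⟩

/-- The weighted `L₂` distance of two curves (by convention, without a square root),
`½ ∫₀ᵀ ‖x - x_d‖²_Q + ‖u - u_d‖²_R dτ + ½ ‖x(T) - x_d(T)‖²_{P_f}`. -/
def curveDist {T : ℝ} (hT : 0 < T) {n m : ℕ} (Q : Matrix (Fin n) (Fin n) ℝ)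
    (R : Matrix (Fin m) (Fin m) ℝ) (Pf : Matrix (Fin n) (Fin n) ℝ) (ξ ξd : Curve T n m) : ℝ :=
  (1 / 2) * (∫ τ, (wsq Q (ξ.1 τ - ξd.1 τ) + wsq R (ξ.2 τ - ξd.2 τ)) ∂(leb T))
    + (1 / 2) * wsq Pf (ξ.1 (finalTime hT) - ξd.1 (finalTime hT))

/-- The weighted `L₂` norm of an output curve (by convention, without a square root),
`∫₀ᵀ α(t)ᵀ W α(t) dt + α(T)ᵀ W₁ α(T)`. -/
def outputNorm {T : ℝ} (hT : 0 < T) {q : ℕ} (W W₁ : Matrix (Fin q) (Fin q) ℝ)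
    (α : Icc (0 : ℝ) T → Vec q) : ℝ :=
  (∫ t, wsq W (α t) ∂(leb T)) + wsq W₁ (α (finalTime hT))

/-- The output map, which selects the states with indices `sel 0, …, sel (q - 1)`. -/
def output {n q : ℕ} (sel : Fin q ↪ Fin n) (x : Vec n) : Vec q :=
  WithLp.toLp 2 fun i => x (sel i)

/-- A scalable feasibility region `{(x, u) | c_j(x, u; ρ) ≤ 0 for all j}`, `ρ ∈ [0, 1]`, given by
`N` constraint functions; `c j ρ (x, u)` stands for `c_j(x, u; ρ)`. -/
structure ScalableRegion (n m N : ℕ) where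
  /-- The constraint functions. -/
  c : Fin N → ℝ → Vec n × Vec m → ℝ
  /-- Each constraint is `C²` in `(x, u)`. -/
  contDiff : ∀ j, ∀ ρ ∈ Icc (0 : ℝ) 1, ContDiff ℝ 2 (c j ρ)
  /-- Regular dependence on `ρ`: the derivatives in `(x, u)` of order `0`, `1`, `2` are jointly
  continuous in `(x, u, ρ)`. No derivative with respect to `ρ` is required. -/
  regular : ∀ j, ∀ i ≤ 2, ContinuousOn
    (fun z : (Vec n × Vec m) × ℝ => iteratedFDeriv ℝ i (c j z.2) z.1) (univ ×ˢ Icc (0 : ℝ) 1)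
  /-- The interior of the region is nonempty and simply connected. -/
  simplyConnected : ∀ ρ ∈ Icc (0 : ℝ) 1,
    (interior {z | ∀ j, c j ρ z ≤ 0}).Nonempty ∧
      IsSimplyConnected (interior {z | ∀ j, c j ρ z ≤ 0})
  /-- The regions shrink as `ρ` grows. -/
  anti : ∀ ρ₁ ρ₂ : ℝ, 0 < ρ₁ → ρ₁ < ρ₂ → ρ₂ ≤ 1 →
    interior {z | ∀ j, c j ρ₂ z ≤ 0} ⊆ interior {z | ∀ j, c j ρ₁ z ≤ 0}
  /-- For each fixed state, the set of strictly feasible inputs is convex. -/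
  convex_input : ∀ ρ ∈ Icc (0 : ℝ) 1, ∀ x : Vec n,
    Convex ℝ {u : Vec m | (x, u) ∈ interior {z | ∀ j, c j ρ z ≤ 0}}

/-- The (closed) feasibility region with scaling parameter `ρ`. -/
def ScalableRegion.region {n m N : ℕ} (C : ScalableRegion n m N) (ρ : ℝ) : Set (Vec n × Vec m) :=
  {z | ∀ j, C.c j ρ z ≤ 0}

/-- The approximate barrier function `β_δ`; `k` is its (even) degree on `z ≤ δ`. -/
def barrierFun (k : ℕ) (δ z : ℝ) : ℝ :=
  if δ < z then -Real.log z
  else ((k : ℝ) - 1) / k * (((z - k * δ) / (((k : ℝ) - 1) * δ)) ^ k - 1) - Real.log δ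

/-- The barrier functional `b_{δ,ρ}(ξ) = ∫₀ᵀ ∑_j β_δ(-c_j(x(τ), u(τ); ρ)) dτ`. -/
def barrier {T : ℝ} {n m N : ℕ} (C : ScalableRegion n m N) (k : ℕ) (δ ρ : ℝ)
    (ξ : Curve T n m) : ℝ :=
  ∫ τ, (∑ j, barrierFun k δ (-(C.c j ρ (ξ.1 τ, ξ.2 τ)))) ∂(leb T)

/-- `ξ₀` is an isolated local minimizer of `g` over `S`: `ξ₀ ∈ S` and there is `r > 0` with
`g(ξ₀) < g(ξ)` for all `ξ ∈ S`, `ξ ≠ ξ₀`, at distance less than `r` from `ξ₀`. -/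
def IsIsolatedLocalMin {X : Type*} [PseudoMetricSpace X] (g : X → ℝ) (S : Set X) (ξ₀ : X) : Prop :=
  ξ₀ ∈ S ∧ ∃ r > 0, ∀ ξ ∈ S, dist ξ ξ₀ < r → ξ ≠ ξ₀ → g ξ₀ < g ξ

end FeasTraj

end

/-!
The existence part is proved by the direct method, applied to the reduced cost `J(u)`, the cost of
the trajectory with input `u`, on a small ball `‖u - u_d‖_∞ ≤ r`. Three facts carry it.

* `J` is strongly midpoint-convex in the `L²` norm of the input (`cost_midpoint_le`). Averaging two
  inputs averages the states up to an error `O(‖u - v‖₂²)` (`norm_sub_midpoint_le`), because `f` is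
  `C²`. The weight `R` contributes the convexity; the curvature of `f` is multiplied by the
  distance to the reference, which is `O(r)`, and the lack of convexity of the barrier by `ε_c`.
  Since the dynamics may be cut off outside a ball, all these estimates can be made global.
* The `L∞` ball is closed in `L¹`, and `J` is Lipschitz there in the `L¹` norm. A minimizing sequence
  is Cauchy by strong convexity, so a minimizer over the ball exists without any weak compactness
  (`exists_minimizer_of_strong_midpoint`, `exists_minimizer`).
* The minimizer is interior (`norm_sub_le_half_of_isMin`). Comparison with `u_d` shows that it is
  `O(ε_c)`-close to `u_d` in `L¹`. If it differed from `u_d` by more than `r / 2` on a set of positive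
  measure, replacing it by `u_d` on that set would lower the input cost by more than the state cost
  and the barrier can rise. So it is a local minimizer in `L∞`, and strict by strong convexity.

All constants are uniform in `ρ ∈ [0, 1]`, since the constraints and their first two derivatives are
bounded on compact sets uniformly in `ρ`, and `β_δ` is convex and locally Lipschitz
(`exists_isSemiconvexOnBall_barrierIntegrand`).

For the suboptimality statements, the barrier and the output norm are continuous along curves in the
`L∞` norm. Near an isolated local minimizer the barrier varies by at most `1`, so local minimality of
the cost gives suboptimality of the weighted distance up to `ε_c`.
-/

noncomputable section

namespace FeasTraj

/-! ### Lebesgue measure on `[0, T]` and Grönwall's inequality -/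

instance isFiniteMeasure_leb (T : ℝ) : IsFiniteMeasure (leb T) := by
  refine ⟨?_⟩
  rw [(MeasurableEmbedding.subtype_coe measurableSet_Icc).comap_apply]
  exact (measure_mono (Subtype.coe_image_subset _ _)).trans_lt (by simp)

lemma leb_real_univ {T : ℝ} (hT : 0 < T) : (leb T).real univ = T := by
  rw [Measure.real, (MeasurableEmbedding.subtype_coe measurableSet_Icc).comap_apply, image_univ,
    Subtype.range_coe]
  simp [hT.le]

lemma setIntegral_leb_Iic {T : ℝ} (hT : 0 < T) {E : Type*} [NormedAddCommGroup E]
    [NormedSpace ℝ E] (h : Icc (0 : ℝ) T → E) (t : Icc (0 : ℝ) T) :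
    ∫ s in Iic t, h s ∂(leb T) = ∫ s in (0 : ℝ)..t, h (projIcc 0 T hT.le s) := by
  have h1 := (MeasurableEmbedding.subtype_coe
    (measurableSet_Icc (a := (0 : ℝ)) (b := T))).setIntegral_map (μ := leb T) (fun s => h (projIcc 0 T hT.le s)) (Iic (t : ℝ))
  rw [map_comap_subtype_coe measurableSet_Icc, Measure.restrict_restrict measurableSet_Iic] at h1
  have h2 : Iic (t : ℝ) ∩ Icc 0 T = Icc 0 (t : ℝ) := by
    ext s
    simp only [mem_inter_iff, mem_Iic, mem_Icc]
    exact ⟨fun h => ⟨h.2.1, h.1⟩, fun h => ⟨h.2, h.1, h.2.trans t.2.2⟩⟩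
  rw [h2, integral_Icc_eq_integral_Ioc, ← intervalIntegral.integral_of_le t.2.1] at h1
  rw [h1]
  simp only [projIcc_val]
  rfl

lemma integrableOn_Iic_projIcc {T : ℝ} (hT : 0 < T) {E : Type*} [NormedAddCommGroup E]
    {h : Icc (0 : ℝ) T → E} (hh : Integrable h (leb T)) :
    IntegrableOn (fun s => h (projIcc 0 T hT.le s)) (Icc 0 T) := by
  have h1 := (MeasurableEmbedding.subtype_coe
    (measurableSet_Icc (a := (0 : ℝ)) (b := T))).integrable_map_iff
    (μ := leb T) (g := fun s => h (projIcc 0 T hT.le s))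
  rw [map_comap_subtype_coe measurableSet_Icc] at h1
  refine h1.2 ?_
  simpa [Function.comp_def] using hh

lemma continuous_primitive_leb {T : ℝ} (hT : 0 < T) {E : Type*} [NormedAddCommGroup E]
    [NormedSpace ℝ E] {h : Icc (0 : ℝ) T → E} (hh : Integrable h (leb T)) :
    Continuous fun t : Icc (0 : ℝ) T => ∫ s in Iic t, h s ∂(leb T) := by
  simp_rw [setIntegral_leb_Iic hT]
  have h1 := integrableOn_Iic_projIcc hT hh
  rw [← uIcc_of_le hT.le] at h1
  have h2 := intervalIntegral.continuousOn_primitive_interval h1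
  rw [uIcc_of_le hT.le] at h2
  exact continuousOn_iff_continuous_domRestrict.1 h2

/-- Exponential weights make the Volterra operator `φ ↦ ∫₀ᵗ φ` small. -/
lemma setIntegral_exp_le {T : ℝ} (hT : 0 < T) {l : ℝ} (hl : 0 < l) (t : Icc (0 : ℝ) T) :
    ∫ s in Iic t, Real.exp (l * s) ∂(leb T) ≤ Real.exp (l * t) / l := by
  rw [setIntegral_leb_Iic hT (fun s => Real.exp (l * s))]
  have : ∫ s in (0 : ℝ)..t, Real.exp (l * (projIcc 0 T hT.le s)) =
      ∫ s in (0 : ℝ)..t, Real.exp (l * s) := by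
    refine intervalIntegral.integral_congr fun s hs => ?_
    rw [uIcc_of_le t.2.1] at hs
    simp [projIcc_of_mem hT.le ⟨hs.1, hs.2.trans t.2.2⟩]
  rw [this, intervalIntegral.integral_comp_mul_left (fun x => Real.exp x) hl.ne', integral_exp]
  rw [smul_eq_mul, inv_mul_eq_div]
  gcongr
  simp

/-- The constant in the integral form of Grönwall's inequality. -/
def gronwallConst (T L : ℝ) : ℝ := 2 * Real.exp ((2 * L + 1) * T)

lemma gronwallConst_pos (T L : ℝ) : 0 < gronwallConst T L := by
  unfold gronwallConst; positivity

lemma le_gronwallConst_mul {T : ℝ} (hT : 0 < T) {y : Icc (0 : ℝ) T → ℝ} (hy : Continuous y)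
    {A L : ℝ} (hA : 0 ≤ A) (hL : 0 ≤ L)
    (h : ∀ t, y t ≤ A + L * ∫ s in Iic t, y s ∂(leb T)) (t : Icc (0 : ℝ) T) :
    y t ≤ gronwallConst T L * A := by
  have hne : Nonempty (Icc (0 : ℝ) T) := ⟨t⟩
  set l : ℝ := 2 * L + 1 with hl
  have hl0 : 0 < l := by positivity
  have hc : Continuous fun s : Icc (0 : ℝ) T => Real.exp (-(l * s)) * y s := by fun_prop
  obtain ⟨t₁, -, ht₁⟩ := isCompact_univ.exists_isMaxOn univ_nonempty hc.continuousOn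
  -- `M` is the maximum of the exponentially weighted function, attained at `t₁`
  set M : ℝ := Real.exp (-(l * t₁)) * y t₁ with hM
  have hle : ∀ s : Icc (0 : ℝ) T, y s ≤ M * Real.exp (l * s) := fun s => by
    have : Real.exp (-(l * s)) * y s ≤ M := ht₁ (mem_univ s)
    rw [Real.exp_neg, inv_mul_le_iff₀ (Real.exp_pos _)] at this
    linarith
  have hi : ∀ g : Icc (0 : ℝ) T → ℝ, Continuous g → Integrable g (leb T) := fun g hg =>
    hg.integrable_of_hasCompactSupport (HasCompactSupport.of_compactSpace _)
  rcases le_or_gt M 0 with hM0 | hM0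
  · have := hle t
    have h2 : M * Real.exp (l * t) ≤ 0 := mul_nonpos_of_nonpos_of_nonneg hM0 (Real.exp_nonneg _)
    have := mul_nonneg (gronwallConst_pos T L).le hA
    linarith
  have h1 : ∫ s in Iic t₁, y s ∂(leb T) ≤ M * (Real.exp (l * t₁) / l) := by
    refine le_trans ?_ (mul_le_mul_of_nonneg_left (setIntegral_exp_le hT hl0 t₁) hM0.le)
    rw [← integral_const_mul]
    exact integral_mono (hi _ hy).integrableOn (hi _ (by fun_prop)).integrableOn hle
  have h2 : M ≤ 2 * A := by
    have h3 := (h t₁).trans (add_le_add_right (mul_le_mul_of_nonneg_left h1 hL) A)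
    have h4 : M ≤ Real.exp (-(l * t₁)) * (A + L * (M * (Real.exp (l * t₁) / l))) :=
      mul_le_mul_of_nonneg_left h3 (Real.exp_nonneg _)
    have h5 : Real.exp (-(l * t₁)) * (A + L * (M * (Real.exp (l * t₁) / l)))
        = Real.exp (-(l * t₁)) * A + L / l * M := by
      rw [Real.exp_neg]; field_simp
    have h6 : Real.exp (-(l * t₁)) * A ≤ 1 * A := by
      gcongr
      rw [Real.exp_le_one_iff]
      have := mul_nonneg hl0.le t₁.2.1
      linarith
    have h7 : L / l ≤ 1 / 2 := by rw [div_le_div_iff₀ hl0 two_pos]; linarith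
    have := mul_le_mul_of_nonneg_right h7 hM0.le
    linarith
  calc y t ≤ M * Real.exp (l * t) := hle t
    _ ≤ 2 * A * Real.exp (l * T) := by
      gcongr
      exact t.2.2
    _ = _ := by unfold gronwallConst; ring

/-- Cauchy–Schwarz on `[0, T]`. -/
lemma sq_integral_le {T : ℝ} (hT : 0 < T) {g : Icc (0 : ℝ) T → ℝ} (hg : Integrable g (leb T))
    (hg2 : Integrable (fun s => g s ^ 2) (leb T)) :
    (∫ s, g s ∂(leb T)) ^ 2 ≤ T * ∫ s, g s ^ 2 ∂(leb T) := by
  set a := ∫ s, g s ∂(leb T) with ha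
  have h0 : 0 ≤ ∫ s, (g s - a / T) ^ 2 ∂(leb T) := integral_nonneg fun s => sq_nonneg _
  have h1 : ∫ s, (g s - a / T) ^ 2 ∂(leb T) = (∫ s, g s ^ 2 ∂(leb T)) - a ^ 2 / T := by
    have : ∀ s, (g s - a / T) ^ 2 = g s ^ 2 - (2 * (a / T)) * g s + (a / T) ^ 2 := fun s => by ring
    simp_rw [this]
    rw [integral_add (f := fun s => g s ^ 2 - 2 * (a / T) * g s) (hg2.sub (hg.const_mul _))
      (integrable_const _), integral_sub hg2 (hg.const_mul _), integral_const_mul, integral_const,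
      leb_real_univ hT, ← ha]
    simp only [smul_eq_mul]
    field_simp
    ring
  rw [h1, sub_nonneg, div_le_iff₀ hT] at h0
  linarith

/-! ### Weighted squares -/

/-- The weighted square as the diagonal of a bounded bilinear form. -/
lemma wsq_eq_inner {d : ℕ} (Q : Matrix (Fin d) (Fin d) ℝ) (v : Vec d) :
    wsq Q v = inner ℝ (Matrix.toEuclideanCLM (𝕜 := ℝ) Q v) v := by
  simp [wsq, EuclideanSpace.inner_eq_star_dotProduct]

lemma continuous_wsq {d : ℕ} (Q : Matrix (Fin d) (Fin d) ℝ) : Continuous (wsq Q) := by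
  simp_rw [funext (wsq_eq_inner Q)]
  fun_prop

lemma wsq_nonneg {d : ℕ} {Q : Matrix (Fin d) (Fin d) ℝ} (hQ : Q.PosSemidef) (v : Vec d) :
    0 ≤ wsq Q v := by
  simpa [wsq] using hQ.dotProduct_mulVec_nonneg v.ofLp

lemma wsq_zero {d : ℕ} (Q : Matrix (Fin d) (Fin d) ℝ) : wsq Q 0 = 0 := by
  simp [wsq]

lemma wsq_midpoint {d : ℕ} (Q : Matrix (Fin d) (Fin d) ℝ) (a b : Vec d) :
    wsq Q ((1 / 2 : ℝ) • (a + b)) = (1 / 2) * (wsq Q a + wsq Q b) - (1 / 4) * wsq Q (a - b) := by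
  simp only [wsq_eq_inner, map_add, map_sub, map_smul, inner_add_left, inner_add_right,
    inner_sub_left, inner_sub_right, inner_smul_left, inner_smul_right]
  simp
  ring

lemma exists_abs_wsq_sub_le {d : ℕ} (Q : Matrix (Fin d) (Fin d) ℝ) :
    ∃ C, 0 ≤ C ∧ ∀ a b : Vec d, |wsq Q a - wsq Q b| ≤ C * ‖a - b‖ * (‖a‖ + ‖b‖) := by
  set A := Matrix.toEuclideanCLM (𝕜 := ℝ) Q with hA
  refine ⟨‖A‖, norm_nonneg _, fun a b => ?_⟩
  have h : wsq Q a - wsq Q b = inner ℝ (A (a - b)) a + inner ℝ (A b) (a - b) := by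
    simp only [wsq_eq_inner, map_sub, inner_sub_left, inner_sub_right, ← hA]
    ring
  rw [h]
  calc _ ≤ ‖A (a - b)‖ * ‖a‖ + ‖A b‖ * ‖a - b‖ :=
        (abs_add_le _ _).trans (add_le_add (abs_real_inner_le_norm _ _) (abs_real_inner_le_norm _ _))
    _ ≤ ‖A‖ * ‖a - b‖ * ‖a‖ + ‖A‖ * ‖b‖ * ‖a - b‖ := by
      gcongr <;> exact A.le_opNorm _
    _ = _ := by ring

lemma exists_le_wsq {d : ℕ} {Q : Matrix (Fin d) (Fin d) ℝ} (hQ : Q.PosDef) :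
    ∃ c, 0 < c ∧ ∀ v : Vec d, c * ‖v‖ ^ 2 ≤ wsq Q v := by
  rcases subsingleton_or_nontrivial (Vec d) with h | h
  · exact ⟨1, one_pos, fun v => by simp [Subsingleton.elim v 0, wsq_zero]⟩
  obtain ⟨v₀, hv₀, hmin⟩ := (isCompact_sphere (0 : Vec d) 1).exists_isMinOn
    (NormedSpace.sphere_nonempty.2 zero_le_one) (continuous_wsq Q).continuousOn
  have hv₀0 : v₀ ≠ 0 := by
    rintro rfl
    simp at hv₀
  refine ⟨wsq Q v₀, ?_, fun v => ?_⟩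
  · have := hQ.dotProduct_mulVec_pos (x := v₀.ofLp) (by simpa using hv₀0)
    simpa [wsq] using this
  rcases eq_or_ne v 0 with rfl | hv
  · simp [wsq_zero]
  have h1 : wsq Q v₀ ≤ wsq Q (‖v‖⁻¹ • v) := hmin (by simp [norm_smul, hv])
  have h2 : wsq Q (‖v‖⁻¹ • v) = (‖v‖ ^ 2)⁻¹ * wsq Q v := by
    simp only [wsq_eq_inner, map_smul, inner_smul_left, inner_smul_right]
    simp
    ring
  rw [h2, le_inv_mul_iff₀ (by positivity)] at h1
  linarith

/-! ### The barrier function -/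

lemma barrierFun_hasDerivAt {k : ℕ} (hk : Even k) (hk2 : 2 ≤ k) {δ : ℝ} (hδ : 0 < δ) (z : ℝ) :
    HasDerivAt (barrierFun k δ)
      (if δ < z then -z⁻¹ else ((z - k * δ) / (((k : ℝ) - 1) * δ)) ^ (k - 1) / δ) z := by
  have hk0 : (0 : ℝ) < k - 1 := by
    have : (2 : ℝ) ≤ k := by exact_mod_cast hk2
    linarith
  have hkpos : (0 : ℝ) < k := by linarith
  have hpoly : ∀ z, HasDerivAt (fun z : ℝ => ((k : ℝ) - 1) / k *
      (((z - k * δ) / (((k : ℝ) - 1) * δ)) ^ k - 1) - Real.log δ)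
      (((z - k * δ) / (((k : ℝ) - 1) * δ)) ^ (k - 1) / δ) z := fun z => by
    have h := ((((((hasDerivAt_id z).sub_const (k * δ)).div_const (((k : ℝ) - 1) * δ)).pow
      k).sub_const 1).const_mul (((k : ℝ) - 1) / k)).sub_const (Real.log δ)
    refine HasDerivAt.congr_deriv h ?_
    simp only [id]
    field_simp
  have hlog : ∀ z, 0 < z → HasDerivAt (fun z : ℝ => -Real.log z) (-z⁻¹) z := fun z hz =>
    (Real.hasDerivAt_log hz.ne').neg
  have hbase : (δ - k * δ) / (((k : ℝ) - 1) * δ) = -1 := by field_simp; ring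
  have hodd : Odd (k - 1) := Nat.Even.sub_odd (by omega) hk odd_one
  rcases lt_trichotomy z δ with h | rfl | h
  · rw [if_neg h.not_gt]
    refine (hpoly z).congr_of_eventuallyEq ?_
    filter_upwards [Iio_mem_nhds h] with w hw
    simp [barrierFun, (mem_Iio.1 hw).le.not_gt]
  · rw [if_neg (lt_irrefl _)]
    rw [← hasDerivWithinAt_univ, ← Iic_union_Ici (a := z)]
    refine HasDerivWithinAt.union ?_ ?_
    · refine (hpoly z).hasDerivWithinAt.congr (fun w hw => ?_) ?_
      · simp [barrierFun, (mem_Iic.1 hw).not_gt]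
      · simp [barrierFun]
    · have hval : barrierFun k z z = -Real.log z := by
        simp [barrierFun, hbase, hk.neg_one_pow]
      have := (hlog z hδ).hasDerivWithinAt (s := Ici z)
      rw [hbase, hodd.neg_one_pow, show (-1 : ℝ) / z = -z⁻¹ by ring]
      refine this.congr (fun w hw => ?_) hval
      rcases (mem_Ici.1 hw).eq_or_lt with rfl | hw'
      · exact hval
      · simp [barrierFun, hw']
  · rw [if_pos h]
    refine (hlog z (hδ.trans h)).congr_of_eventuallyEq ?_
    filter_upwards [Ioi_mem_nhds h] with w hw
    simp [barrierFun, mem_Ioi.1 hw]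

lemma convexOn_barrierFun {k : ℕ} (hk : Even k) (hk2 : 2 ≤ k) {δ : ℝ} (hδ : 0 < δ) :
    ConvexOn ℝ univ (barrierFun k δ) := by
  have hd := barrierFun_hasDerivAt hk hk2 hδ
  refine Monotone.convexOn_univ_of_deriv (fun z => (hd z).differentiableAt) fun a b hab => ?_
  rw [(hd a).deriv, (hd b).deriv]
  have hk0 : (0 : ℝ) < k - 1 := by
    have : (2 : ℝ) ≤ k := by exact_mod_cast hk2
    linarith
  have hodd : Odd (k - 1) := Nat.Even.sub_odd (by omega) hk odd_one
  have hpoly : ∀ a b : ℝ, a ≤ b → ((a - k * δ) / (((k : ℝ) - 1) * δ)) ^ (k - 1) / δ ≤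
      ((b - k * δ) / (((k : ℝ) - 1) * δ)) ^ (k - 1) / δ := fun a b hab => by
    refine div_le_div_of_nonneg_right (hodd.strictMono_pow.monotone ?_) hδ.le
    gcongr
  have hbase : (δ - k * δ) / (((k : ℝ) - 1) * δ) = -1 := by field_simp; ring
  split_ifs with h1 h2 h2
  · exact neg_le_neg (inv_anti₀ (hδ.trans h1) hab)
  · exact absurd (h1.trans_le hab) h2
  · refine (hpoly a δ (not_lt.1 h1)).trans ?_
    rw [hbase, hodd.neg_one_pow, show (-1 : ℝ) / δ = -δ⁻¹ by ring]
    exact neg_le_neg (inv_anti₀ hδ h2.le)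
  · exact hpoly a b hab

lemma continuous_barrierFun {k : ℕ} (hk : Even k) (hk2 : 2 ≤ k) {δ : ℝ} (hδ : 0 < δ) :
    Continuous (barrierFun k δ) :=
  continuous_iff_continuousAt.2 fun z => (barrierFun_hasDerivAt hk hk2 hδ z).continuousAt

lemma exists_lipschitz_barrierFun {k : ℕ} (hk : Even k) (hk2 : 2 ≤ k) {δ : ℝ} (hδ : 0 < δ)
    (M : ℝ) : ∃ L, 0 ≤ L ∧ ∀ a b : ℝ, |a| ≤ M → |b| ≤ M →
      |barrierFun k δ a - barrierFun k δ b| ≤ L * |a - b| := by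
  have hb : Bornology.IsBounded (barrierFun k δ '' Metric.ball 0 (M + 2)) :=
    ((isCompact_closedBall (0 : ℝ) (M + 2)).image
      (continuous_barrierFun hk hk2 hδ)).isBounded.subset (image_mono Metric.ball_subset_closedBall)
  obtain ⟨K, hK⟩ := ((convexOn_barrierFun hk hk2 hδ).subset (subset_univ _)
    (convex_ball 0 (M + 2))).exists_lipschitzOnWith_of_isBounded (r' := M + 1) (by linarith) hb
  refine ⟨K, K.2, fun a b ha hb => ?_⟩
  have := hK.dist_le_mul a (by simp; linarith) b (by simp; linarith)
  simpa [Real.dist_eq] using this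

/-! ### Midpoint estimates for functions with two bounded derivatives -/

lemma half_smul_add_mem_of_convex {E : Type*} [AddCommGroup E] [Module ℝ E] {s : Set E}
    (hs : Convex ℝ s) {a b : E} (ha : a ∈ s) (hb : b ∈ s) : (1 / 2 : ℝ) • (a + b) ∈ s := by
  rw [smul_add]
  exact hs ha hb (by norm_num) (by norm_num) (by norm_num)

lemma norm_midpoint_sub_le {E G : Type*} [NormedAddCommGroup E] [NormedSpace ℝ E]
    [NormedAddCommGroup G] [NormedSpace ℝ G] {h : E → G} (hh : ContDiff ℝ 2 h) {s : Set E}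
    (hs : Convex ℝ s) {B : ℝ} (hB : ∀ z ∈ s, ‖iteratedFDeriv ℝ 2 h z‖ ≤ B) {a b : E}
    (ha : a ∈ s) (hb : b ∈ s) :
    ‖h ((1 / 2 : ℝ) • (a + b)) - (1 / 2 : ℝ) • (h a + h b)‖ ≤ B * ‖a - b‖ ^ 2 := by
  set c := (1 / 2 : ℝ) • (a + b) with hc
  have hcs : c ∈ s := half_smul_add_mem_of_convex hs ha hb
  have hB0 : 0 ≤ B := (norm_nonneg _).trans (hB a ha)
  have hd : Differentiable ℝ h := hh.differentiable (by norm_num)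
  have hd' : Differentiable ℝ (fderiv ℝ h) :=
    (hh.fderiv_right (m := 1) (by norm_num)).differentiable (by norm_num)
  have hlip : ∀ z ∈ s, ‖fderiv ℝ h z - fderiv ℝ h c‖ ≤ B * ‖z - c‖ := fun z hz =>
    hs.norm_image_sub_le_of_norm_fderiv_le (𝕜 := ℝ) (fun w _ => hd' w) (fun w hw => by
      rw [← norm_iteratedFDeriv_one, norm_iteratedFDeriv_fderiv]
      exact hB w hw) hcs hz
  -- first-order Taylor estimate at the midpoint
  have key : ∀ z ∈ s, ‖h z - h c - fderiv ℝ h c (z - c)‖ ≤ B * ‖z - c‖ * ‖z - c‖ := fun z hz => by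
    refine (convex_segment c z).norm_image_sub_le_of_norm_fderiv_le' (𝕜 := ℝ) (fun w _ => hd w)
      (fun w hw => ?_) (left_mem_segment ℝ c z) (right_mem_segment ℝ c z)
    refine (hlip w (hs.segment_subset hcs hz hw)).trans ?_
    gcongr
    rw [← dist_eq_norm, ← dist_eq_norm]
    have := dist_add_dist_of_mem_segment hw
    rw [dist_comm c w, dist_comm c z] at this
    linarith [dist_nonneg (x := w) (y := z)]
  have ha' : a - c = (1 / 2 : ℝ) • (a - b) := by rw [hc]; module
  have hb' : b - c = -(a - c) := by rw [hc]; module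
  have hna : ‖a - c‖ = 1 / 2 * ‖a - b‖ := by rw [ha', norm_smul]; norm_num
  have e : h c - (1 / 2 : ℝ) • (h a + h b) = -(1 / 2 : ℝ) • ((h a - h c - fderiv ℝ h c (a - c)) +
      (h b - h c - fderiv ℝ h c (b - c))) := by
    rw [hb', map_neg]; module
  have h1 := key a ha
  have h2 := key b hb
  rw [hb', map_neg, norm_neg, ← map_neg, ← hb'] at h2
  rw [e, norm_smul]
  have h3 := norm_add_le (h a - h c - fderiv ℝ h c (a - c)) (h b - h c - fderiv ℝ h c (b - c))
  rw [hna] at h1 h2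
  have h4 : ‖(-(1 / 2) : ℝ)‖ = 1 / 2 := by norm_num
  rw [h4]
  nlinarith [mul_nonneg hB0 (sq_nonneg ‖a - b‖)]

/-! ### The controlled integral equation -/

/-- The continuous state `x` solves `x(t) = x₀ + ∫₀ᵗ F(x(s), u(s)) ds` on `[0, T]`. The input `u` is
a function rather than a class in some `Lᵖ`, so that one relation serves all integrability
classes. -/
def IsSol {T : ℝ} {n m : ℕ} (F : Vec n × Vec m → Vec n) (x₀ : Vec n) (x : C(Icc (0 : ℝ) T, Vec n))
    (u : Icc (0 : ℝ) T → Vec m) : Prop :=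
  ∀ t, x t = x₀ + ∫ s in Iic t, F (x s, u s) ∂(leb T)

/-- A bounded continuous vector field with global Lipschitz constant `L` and global constant `K`
in the second-order midpoint estimate. -/
structure IsTame {n m : ℕ} (F : Vec n × Vec m → Vec n) (L K : ℝ) : Prop where
  continuous : Continuous F
  bounded : ∃ B, ∀ z, ‖F z‖ ≤ B
  lip_nonneg : 0 ≤ L
  mid_nonneg : 0 ≤ K
  lip : ∀ a b, ‖F a - F b‖ ≤ L * ‖a - b‖
  mid : ∀ a b, ‖F ((1 / 2 : ℝ) • (a + b)) - (1 / 2 : ℝ) • (F a + F b)‖ ≤ K * ‖a - b‖ ^ 2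

/-- Cutting off a `C²` vector field outside a ball makes it tame. -/
lemma exists_isTame_eq_on_ball {n m : ℕ} {f : Vec n × Vec m → Vec n} (hf : ContDiff ℝ 2 f)
    (M : ℝ) : ∃ F L K, IsTame F L K ∧ ∀ z, ‖z‖ ≤ M → F z = f z := by
  let χ : ContDiffBump (0 : Vec n × Vec m) :=
    ⟨|M| + 1, |M| + 2, by positivity, by linarith⟩
  set F : Vec n × Vec m → Vec n := fun z => χ z • f z with hF
  have hFc : ContDiff ℝ 2 F := χ.contDiff.smul hf
  have hsupp : HasCompactSupport F := χ.hasCompactSupport.smul_right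
  obtain ⟨L, hL⟩ := hFc.lipschitzWith_of_hasCompactSupport hsupp (by norm_num)
  obtain ⟨K, hK⟩ := (hFc.continuous_iteratedFDeriv (m := 2) le_rfl).bounded_above_of_compact_support
    (hsupp.iteratedFDeriv (𝕜 := ℝ) 2)
  refine ⟨F, L, K, ⟨hFc.continuous, hFc.continuous.bounded_above_of_compact_support hsupp, L.2,
    (norm_nonneg _).trans (hK 0), fun a b => ?_, fun a b => ?_⟩, fun z hz => ?_⟩
  · simpa [dist_eq_norm] using hL.dist_le_mul a b
  · exact norm_midpoint_sub_le hFc convex_univ (fun z _ => hK z) (mem_univ a) (mem_univ b)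
  · have : χ z = 1 := χ.one_of_mem_closedBall (by
      rw [mem_closedBall_zero_iff]
      exact hz.trans ((le_abs_self M).trans (by simp [χ])))
    simp [hF, this]

lemma integrable_of_continuous {T : ℝ} {E : Type*} [NormedAddCommGroup E]
    {g : Icc (0 : ℝ) T → E} (hg : Continuous g) : Integrable g (leb T) :=
  hg.integrable_of_hasCompactSupport (HasCompactSupport.of_compactSpace _)

lemma aestronglyMeasurable_prodMk {T : ℝ} {n m : ℕ} (x : C(Icc (0 : ℝ) T, Vec n))
    {u : Icc (0 : ℝ) T → Vec m} (hu : AEStronglyMeasurable u (leb T)) :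
    AEStronglyMeasurable (fun s => (x s, u s)) (leb T) :=
  x.continuous.aestronglyMeasurable.prodMk hu

section Solutions

variable {T : ℝ} {n m : ℕ} {F : Vec n × Vec m → Vec n} {L K : ℝ} {x₀ : Vec n}

lemma IsTame.integrable (hF : IsTame F L K) (x : C(Icc (0 : ℝ) T, Vec n))
    {u : Icc (0 : ℝ) T → Vec m} (hu : AEStronglyMeasurable u (leb T)) :
    Integrable (fun s => F (x s, u s)) (leb T) := by
  obtain ⟨B, hB⟩ := hF.bounded
  exact .of_bound (hF.continuous.comp_aestronglyMeasurable (aestronglyMeasurable_prodMk x hu)) B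
    (.of_forall fun s => hB _)

/-- Global existence: in the variable `e^{-λt} x(t)` with `λ` large the Picard operator is a
contraction of the whole space of continuous functions. -/
lemma IsTame.exists_isSol (hF : IsTame F L K) (hT : 0 < T) (x₀ : Vec n)
    {u : Icc (0 : ℝ) T → Vec m} (hu : AEStronglyMeasurable u (leb T)) :
    ∃ x, IsSol F x₀ x u := by
  have hL := hF.lip_nonneg
  set l : ℝ := 2 * L + 1 with hl
  have hl0 : 0 < l := by positivity
  have : Nonempty (Icc (0 : ℝ) T) := ⟨⟨0, le_rfl, hT.le⟩⟩
  let w : C(Icc (0 : ℝ) T, Vec n) → C(Icc (0 : ℝ) T, Vec n) := fun y =>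
    ⟨fun s => Real.exp (l * s) • y s, by fun_prop⟩
  let Ψ : C(Icc (0 : ℝ) T, Vec n) → C(Icc (0 : ℝ) T, Vec n) := fun y =>
    ⟨fun t => Real.exp (-(l * t)) • (x₀ + ∫ s in Iic t, F (w y s, u s) ∂(leb T)), by
      have := continuous_primitive_leb hT (hF.integrable (w y) hu)
      fun_prop⟩
  have hΨ : ContractingWith (1 / 2) Ψ := by
    refine ⟨by rw [← NNReal.coe_lt_coe]; norm_num, LipschitzWith.of_dist_le_mul fun y z => ?_⟩
    refine (ContinuousMap.dist_le_iff_of_nonempty).2 fun t => ?_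
    have h1 : ‖∫ s in Iic t, (F (w y s, u s) - F (w z s, u s)) ∂(leb T)‖ ≤
        ∫ s in Iic t, L * dist y z * Real.exp (l * s) ∂(leb T) := by
      refine norm_integral_le_of_norm_le
        (integrable_of_continuous (by fun_prop)).integrableOn (.of_forall fun s => ?_)
      refine (hF.lip _ _).trans ?_
      rw [mul_assoc]
      refine mul_le_mul_of_nonneg_left ?_ hL
      have : (w y s, u s) - (w z s, u s) = (Real.exp (l * s) • (y s - z s), 0) := by
        simp [w, smul_sub]
      rw [this, Prod.norm_mk, norm_zero, max_eq_left (norm_nonneg _), norm_smul,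
        Real.norm_eq_abs, Real.abs_exp, mul_comm, ← dist_eq_norm]
      exact mul_le_mul_of_nonneg_right (ContinuousMap.dist_apply_le_dist s) (Real.exp_nonneg _)
    rw [integral_const_mul, integral_sub (hF.integrable (w y) hu).integrableOn
      (hF.integrable (w z) hu).integrableOn] at h1
    have h2 : Ψ y t - Ψ z t = Real.exp (-(l * t)) • (∫ s in Iic t, F (w y s, u s) ∂(leb T) -
        ∫ s in Iic t, F (w z s, u s) ∂(leb T)) := by
      simp only [Ψ, ContinuousMap.coe_mk]
      module
    rw [dist_eq_norm, h2, norm_smul, Real.norm_eq_abs, Real.abs_exp]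
    calc _ ≤ Real.exp (-(l * t)) * (L * dist y z * (Real.exp (l * t) / l)) := by
          gcongr
          exact h1.trans (by gcongr; exact setIntegral_exp_le hT hl0 t)
      _ = L / l * dist y z := by rw [Real.exp_neg]; field_simp
      _ ≤ _ := by
        gcongr
        rw [div_le_iff₀ hl0]
        push_cast
        linarith
  have hfix := hΨ.fixedPoint_isFixedPt
  set y := ContractingWith.fixedPoint Ψ hΨ
  refine ⟨w y, fun t => ?_⟩
  have h : Ψ y t = y t := by rw [hfix]
  have hw : w y t = Real.exp (l * t) • y t := rfl
  rw [hw, ← h]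
  simp only [Ψ, ContinuousMap.coe_mk]
  rw [smul_smul, ← Real.exp_add]
  simp

/-- States depend on inputs in a Lipschitz way, from the `L¹` norm to the uniform norm. -/
lemma IsTame.norm_sub_le (hF : IsTame F L K) (hT : 0 < T) {x y : C(Icc (0 : ℝ) T, Vec n)}
    {u v : Icc (0 : ℝ) T → Vec m} (hx : IsSol F x₀ x u) (hy : IsSol F x₀ y v)
    (hu : Integrable u (leb T)) (hv : Integrable v (leb T)) (t : Icc (0 : ℝ) T) :
    ‖x t - y t‖ ≤ gronwallConst T L * L * ∫ s, ‖u s - v s‖ ∂(leb T) := by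
  have hL := hF.lip_nonneg
  have hi : Integrable (fun s => ‖x s - y s‖) (leb T) := integrable_of_continuous (by fun_prop)
  have huv : Integrable (fun s => ‖u s - v s‖) (leb T) := (hu.sub hv).norm
  rw [mul_assoc]
  refine le_gronwallConst_mul hT (y := fun t => ‖x t - y t‖) (by fun_prop)
    (mul_nonneg hL (integral_nonneg fun s => norm_nonneg _)) hL (fun t => ?_) t
  rw [hx t, hy t, add_sub_add_left_eq_sub, ← integral_sub
    (hF.integrable x hu.1).integrableOn (hF.integrable y hv.1).integrableOn]
  calc _ ≤ ∫ s in Iic t, (L * ‖u s - v s‖ + L * ‖x s - y s‖) ∂(leb T) := by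
        refine norm_integral_le_of_norm_le
          ((huv.const_mul L).add (hi.const_mul L)).integrableOn (.of_forall fun s => ?_)
        refine (hF.lip _ _).trans ?_
        rw [← mul_add]
        refine mul_le_mul_of_nonneg_left ?_ hL
        rw [Prod.norm_def, add_comm]
        exact max_le_add_of_nonneg (norm_nonneg _) (norm_nonneg _)
    _ ≤ _ := by
        rw [integral_add (huv.const_mul L).integrableOn (hi.const_mul L).integrableOn,
          integral_const_mul, integral_const_mul]
        gcongr
        · exact .of_forall fun s => norm_nonneg _
        · exact Measure.restrict_le_self

lemma IsTame.isSol_unique (hF : IsTame F L K) (hT : 0 < T) {x y : C(Icc (0 : ℝ) T, Vec n)}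
    {u v : Icc (0 : ℝ) T → Vec m} (hx : IsSol F x₀ x u) (hy : IsSol F x₀ y v)
    (hu : Integrable u (leb T)) (hv : Integrable v (leb T)) (huv : u =ᵐ[leb T] v) : x = y := by
  ext1 t
  have h := hF.norm_sub_le hT hx hy hu hv t
  rw [integral_eq_zero_of_ae (by filter_upwards [huv] with s hs; simp [hs]), mul_zero] at h
  exact sub_eq_zero.1 (norm_le_zero_iff.1 h)

/-- The constant relating the squared `L²` distance of two trajectories to that of their inputs. -/
def sqConst (T L : ℝ) : ℝ := (T * (gronwallConst T L * L)) ^ 2 + 1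

lemma sqConst_pos (T L : ℝ) : 0 < sqConst T L := by unfold sqConst; positivity

lemma IsTame.integral_sq_le (hF : IsTame F L K) (hT : 0 < T) {x y : C(Icc (0 : ℝ) T, Vec n)}
    {u v : Icc (0 : ℝ) T → Vec m} (hx : IsSol F x₀ x u) (hy : IsSol F x₀ y v)
    (hu : Integrable u (leb T)) (hv : Integrable v (leb T))
    (huv : Integrable (fun s => ‖u s - v s‖ ^ 2) (leb T)) :
    ∫ s, (‖x s - y s‖ ^ 2 + ‖u s - v s‖ ^ 2) ∂(leb T) ≤
      sqConst T L * ∫ s, ‖u s - v s‖ ^ 2 ∂(leb T) := by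
  have hi : Integrable (fun s => ‖x s - y s‖ ^ 2) (leb T) := integrable_of_continuous (by fun_prop)
  have hG : 0 ≤ gronwallConst T L * L := mul_nonneg (gronwallConst_pos T L).le hF.lip_nonneg
  have h1 : ∫ s, ‖x s - y s‖ ^ 2 ∂(leb T) ≤
      ∫ s, (gronwallConst T L * L * ∫ s, ‖u s - v s‖ ∂(leb T)) ^ 2 ∂(leb T) := by
    refine integral_mono hi (integrable_const _) fun s => ?_
    exact pow_le_pow_left₀ (norm_nonneg _) (hF.norm_sub_le hT hx hy hu hv s) 2
  rw [integral_const, leb_real_univ hT, smul_eq_mul, mul_pow] at h1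
  have h2 := sq_integral_le hT (hu.sub hv).norm huv
  have h3 : T * ((gronwallConst T L * L) ^ 2 * (∫ s, ‖u s - v s‖ ∂(leb T)) ^ 2) ≤
      T * ((gronwallConst T L * L) ^ 2 * (T * ∫ s, ‖u s - v s‖ ^ 2 ∂(leb T))) := by
    gcongr
    exact h2
  rw [integral_add hi huv, sqConst]
  nlinarith

/-- Averaging the inputs averages the states, up to an error of second order. -/
lemma IsTame.norm_sub_midpoint_le (hF : IsTame F L K) (hT : 0 < T)
    {x y z : C(Icc (0 : ℝ) T, Vec n)} {u v w : Icc (0 : ℝ) T → Vec m}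
    (hx : IsSol F x₀ x u) (hy : IsSol F x₀ y v) (hz : IsSol F x₀ z w)
    (hu : Integrable u (leb T)) (hv : Integrable v (leb T)) (hw : AEStronglyMeasurable w (leb T))
    (huv : Integrable (fun s => ‖u s - v s‖ ^ 2) (leb T))
    (hwuv : ∀ᵐ s ∂(leb T), w s = (1 / 2 : ℝ) • (u s + v s)) (t : Icc (0 : ℝ) T) :
    ‖z t - (1 / 2 : ℝ) • (x t + y t)‖ ≤
      gronwallConst T L * (K * sqConst T L) * ∫ s, ‖u s - v s‖ ^ 2 ∂(leb T) := by
  have hL := hF.lip_nonneg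
  have hK := hF.mid_nonneg
  have hi : Integrable (fun s => ‖x s - y s‖ ^ 2 + ‖u s - v s‖ ^ 2) (leb T) :=
    (integrable_of_continuous (by fun_prop)).add huv
  have he : Integrable (fun s => ‖z s - (1 / 2 : ℝ) • (x s + y s)‖) (leb T) :=
    integrable_of_continuous (by fun_prop)
  have hsq := hF.integral_sq_le hT hx hy hu hv huv
  have hint : 0 ≤ ∫ s, ‖u s - v s‖ ^ 2 ∂(leb T) := integral_nonneg fun s => by positivity
  rw [mul_assoc]
  refine le_gronwallConst_mul hT (y := fun t => ‖z t - (1 / 2 : ℝ) • (x t + y t)‖) (by fun_prop)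
    (mul_nonneg (mul_nonneg hK (sqConst_pos T L).le) hint) hL (fun t => ?_) t
  have hFx := (hF.integrable x hu.1).integrableOn (s := Iic t)
  have hFy := (hF.integrable y hv.1).integrableOn (s := Iic t)
  have hFz := (hF.integrable z hw).integrableOn (s := Iic t)
  have e : z t - (1 / 2 : ℝ) • (x t + y t) = ∫ s in Iic t,
      (F (z s, w s) - (1 / 2 : ℝ) • (F (x s, u s) + F (y s, v s))) ∂(leb T) := by
    rw [integral_sub hFz (g := fun s => (1 / 2 : ℝ) • (F (x s, u s) + F (y s, v s)))
      ((hFx.add hFy).smul (1 / 2 : ℝ)), integral_smul, integral_add hFx hFy,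
      hx t, hy t, hz t]
    module
  rw [e]
  calc _ ≤ ∫ s in Iic t, (K * (‖x s - y s‖ ^ 2 + ‖u s - v s‖ ^ 2) +
          L * ‖z s - (1 / 2 : ℝ) • (x s + y s)‖) ∂(leb T) := by
        refine norm_integral_le_of_norm_le ((hi.const_mul K).add (he.const_mul L)).integrableOn
          ((ae_restrict_of_ae hwuv).mono fun s hs => ?_)
        have h1 := hF.lip (z s, w s) ((1 / 2 : ℝ) • ((x s, u s) + (y s, v s)))
        have h2 := hF.mid (x s, u s) (y s, v s)
        have h3 : (z s, w s) - (1 / 2 : ℝ) • ((x s, u s) + (y s, v s)) =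
            (z s - (1 / 2 : ℝ) • (x s + y s), 0) := by
          simp [hs]
        have h4 : ‖(x s, u s) - (y s, v s)‖ ^ 2 ≤ ‖x s - y s‖ ^ 2 + ‖u s - v s‖ ^ 2 := by
          rw [Prod.mk_sub_mk, Prod.norm_mk]
          rcases max_cases ‖x s - y s‖ ‖u s - v s‖ with h | h <;> rw [h.1]
          · linarith [sq_nonneg ‖u s - v s‖]
          · linarith [sq_nonneg ‖x s - y s‖]
        rw [h3, Prod.norm_mk, norm_zero, max_eq_left (norm_nonneg _)] at h1
        have h5 := norm_sub_le_norm_sub_add_norm_sub (F (z s, w s))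
          (F ((1 / 2 : ℝ) • ((x s, u s) + (y s, v s))))
          ((1 / 2 : ℝ) • (F (x s, u s) + F (y s, v s)))
        have := mul_le_mul_of_nonneg_left h4 hK
        linarith
    _ ≤ _ := by
        rw [integral_add (hi.const_mul K).integrableOn (he.const_mul L).integrableOn,
          integral_const_mul, integral_const_mul, mul_assoc K]
        gcongr
        exact (setIntegral_le_integral hi (.of_forall fun s => by positivity)).trans hsq

end Solutions

/-! ### The barrier along curves -/

/-- A continuous function that is `L`-Lipschitz on the ball of radius `M` about the origin, and
there convex at midpoints up to the error `K ‖a - b‖²`. -/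
structure IsSemiconvexOnBall {E : Type*} [NormedAddCommGroup E] [NormedSpace ℝ E] (φ : E → ℝ)
    (M L K : ℝ) : Prop where
  continuous : Continuous φ
  lip_nonneg : 0 ≤ L
  mid_nonneg : 0 ≤ K
  lip : ∀ a b, ‖a‖ ≤ M → ‖b‖ ≤ M → |φ a - φ b| ≤ L * ‖a - b‖
  mid : ∀ a b, ‖a‖ ≤ M → ‖b‖ ≤ M →
    φ ((1 / 2 : ℝ) • (a + b)) ≤ (1 / 2) * (φ a + φ b) + K * ‖a - b‖ ^ 2

lemma IsSemiconvexOnBall.sum {E : Type*} [NormedAddCommGroup E] [NormedSpace ℝ E] {N : ℕ}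
    {φ : Fin N → E → ℝ} {M : ℝ} {L K : Fin N → ℝ}
    (h : ∀ j, IsSemiconvexOnBall (φ j) M (L j) (K j)) :
    IsSemiconvexOnBall (fun z => ∑ j, φ j z) M (∑ j, L j) (∑ j, K j) where
  continuous := continuous_finsetSum _ fun j _ => (h j).continuous
  lip_nonneg := Finset.sum_nonneg fun j _ => (h j).lip_nonneg
  mid_nonneg := Finset.sum_nonneg fun j _ => (h j).mid_nonneg
  lip a b ha hb := by
    rw [← Finset.sum_sub_distrib, Finset.sum_mul]
    exact (Finset.abs_sum_le_sum_abs _ _).trans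
      (Finset.sum_le_sum fun j _ => (h j).lip a b ha hb)
  mid a b ha hb := by
    rw [← Finset.sum_add_distrib, Finset.mul_sum, Finset.sum_mul, ← Finset.sum_add_distrib]
    exact Finset.sum_le_sum fun j _ => (h j).mid a b ha hb

/-- The integrand `∑_j β_δ(-c_j(x, u; ρ))` of the barrier functional. -/
def barrierIntegrand {n m N : ℕ} (C : ScalableRegion n m N) (k : ℕ) (δ ρ : ℝ)
    (z : Vec n × Vec m) : ℝ := ∑ j, barrierFun k δ (-(C.c j ρ z))

/-- Joint continuity in `ρ` of the derivatives of the constraints makes the estimates uniform in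
`ρ`. The midpoint estimate combines that of the constraints with convexity of `β_δ`. -/
lemma exists_isSemiconvexOnBall_barrierIntegrand {n m N : ℕ} (C : ScalableRegion n m N) {k : ℕ}
    (hk : Even k) (hk2 : 2 ≤ k) {δ : ℝ} (hδ : 0 < δ) (M : ℝ) :
    ∃ L K, ∀ ρ ∈ Icc (0 : ℝ) 1, IsSemiconvexOnBall (barrierIntegrand C k δ ρ) M L K := by
  have key : ∀ j, ∃ L K, ∀ ρ ∈ Icc (0 : ℝ) 1,
      IsSemiconvexOnBall (fun z => barrierFun k δ (-(C.c j ρ z))) M L K := fun j => by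
    have hbd : ∀ i ≤ 2, ∃ B, 0 ≤ B ∧ ∀ ρ ∈ Icc (0 : ℝ) 1, ∀ z : Vec n × Vec m, ‖z‖ ≤ M →
        ‖iteratedFDeriv ℝ i (C.c j ρ) z‖ ≤ B := fun i hi => by
      obtain ⟨B, hB⟩ := ((isCompact_closedBall (0 : Vec n × Vec m) M).prod
        (isCompact_Icc (a := (0 : ℝ)) (b := 1))).exists_bound_of_continuousOn
        ((C.regular j i hi).mono (prod_mono (subset_univ _) subset_rfl))
      exact ⟨max B 0, le_max_right _ _, fun ρ hρ z hz =>
        (hB (z, ρ) ⟨mem_closedBall_zero_iff.2 hz, hρ⟩).trans (le_max_left _ _)⟩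
    obtain ⟨B₀, -, hB₀⟩ := hbd 0 (by norm_num)
    obtain ⟨B₁, hB₁0, hB₁⟩ := hbd 1 (by norm_num)
    obtain ⟨B₂, hB₂0, hB₂⟩ := hbd 2 le_rfl
    obtain ⟨L, hL0, hL⟩ := exists_lipschitz_barrierFun hk hk2 hδ B₀
    refine ⟨L * B₁, L * B₂, fun ρ hρ => ?_⟩
    have hC := C.contDiff j ρ hρ
    have hconv : Convex ℝ {z : Vec n × Vec m | ‖z‖ ≤ M} := by
      have h := convex_closedBall (0 : Vec n × Vec m) M
      rwa [show Metric.closedBall (0 : Vec n × Vec m) M = {z | ‖z‖ ≤ M} from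
        ext fun z => mem_closedBall_zero_iff] at h
    have hc : ∀ z, ‖z‖ ≤ M → |-(C.c j ρ z)| ≤ B₀ := fun z hz => by
      simpa using hB₀ ρ hρ z hz
    refine ⟨(continuous_barrierFun hk hk2 hδ).comp hC.continuous.neg, by positivity,
      by positivity, fun a b ha hb => ?_, fun a b ha hb => ?_⟩
    · refine (hL _ _ (hc a ha) (hc b hb)).trans ?_
      rw [mul_assoc]
      refine mul_le_mul_of_nonneg_left ?_ hL0
      have h1 := hconv.norm_image_sub_le_of_norm_fderiv_le (𝕜 := ℝ) (f := C.c j ρ) (C := B₁)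
        (fun w _ => hC.differentiable (by norm_num) w)
        (fun w hw => by rw [← norm_iteratedFDeriv_one]; exact hB₁ ρ hρ w hw) hb ha
      rw [neg_sub_neg, abs_sub_comm]
      simpa using h1
    · set a' := -(C.c j ρ a)
      set b' := -(C.c j ρ b)
      have hmid := norm_midpoint_sub_le hC hconv (fun z hz => hB₂ ρ hρ z hz) ha hb
      have hm := hc _ (half_smul_add_mem_of_convex hconv ha hb)
      have hab : |(1 / 2) * (a' + b')| ≤ B₀ := by
        have h1 := abs_le.1 (hc a ha)
        have h2 := abs_le.1 (hc b hb)
        rw [abs_le]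
        constructor <;> linarith
      have h1 := (abs_le.1 (hL _ _ hm hab)).2
      have h2 := (convexOn_barrierFun hk hk2 hδ).2 (mem_univ a') (mem_univ b')
        (one_half_pos (α := ℝ)).le (one_half_pos (α := ℝ)).le (add_halves 1)
      simp only [smul_eq_mul] at h2
      rw [← mul_add, ← mul_add] at h2
      have h3 : |-(C.c j ρ ((1 / 2 : ℝ) • (a + b))) - (1 / 2) * (a' + b')| ≤
          B₂ * ‖a - b‖ ^ 2 := by
        have e : -(C.c j ρ ((1 / 2 : ℝ) • (a + b))) - (1 / 2) * (a' + b') =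
            -(C.c j ρ ((1 / 2 : ℝ) • (a + b)) - (1 / 2 : ℝ) • (C.c j ρ a + C.c j ρ b)) := by
          simp only [a', b', smul_eq_mul]
          ring
        rw [e, abs_neg]
        exact hmid
      have h4 := mul_le_mul_of_nonneg_left h3 hL0
      linarith
  choose L K h using key
  exact ⟨_, _, fun ρ hρ => IsSemiconvexOnBall.sum fun j => h j ρ hρ⟩

/-- The integral of `φ` along a curve. -/
def pathIntegral {T : ℝ} {n m : ℕ} (φ : Vec n × Vec m → ℝ)
    (x : C(Icc (0 : ℝ) T, Vec n)) (u : Icc (0 : ℝ) T → Vec m) : ℝ :=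
  ∫ τ, φ (x τ, u τ) ∂(leb T)

section PathIntegral

variable {T : ℝ} {n m : ℕ} {φ : Vec n × Vec m → ℝ} {M L K : ℝ}
  {x y z : C(Icc (0 : ℝ) T, Vec n)} {u v w : Icc (0 : ℝ) T → Vec m}

lemma IsSemiconvexOnBall.integrable (h : IsSemiconvexOnBall φ M L K)
    (hu : AEStronglyMeasurable u (leb T)) (hxu : ∀ᵐ s ∂(leb T), ‖(x s, u s)‖ ≤ M) :
    Integrable (fun s => φ (x s, u s)) (leb T) := by
  refine .of_bound (h.continuous.comp_aestronglyMeasurable (aestronglyMeasurable_prodMk x hu))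
    (|φ 0| + L * M) (hxu.mono fun s hs => ?_)
  have h1 := h.lip (x s, u s) 0 hs (by simpa using (norm_nonneg _).trans hs)
  have h2 : L * ‖(x s, u s) - 0‖ ≤ L * M := by
    rw [sub_zero]
    exact mul_le_mul_of_nonneg_left hs h.lip_nonneg
  have h3 := abs_sub_abs_le_abs_sub (φ (x s, u s)) (φ 0)
  rw [Real.norm_eq_abs]
  linarith

lemma IsSemiconvexOnBall.pathIntegral_sub_le (h : IsSemiconvexOnBall φ M L K) (hT : 0 < T)
    (hu : Integrable u (leb T)) (hv : Integrable v (leb T))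
    (hxu : ∀ᵐ s ∂(leb T), ‖(x s, u s)‖ ≤ M) (hyv : ∀ᵐ s ∂(leb T), ‖(y s, v s)‖ ≤ M) {e : ℝ}
    (he : ∀ s, ‖x s - y s‖ ≤ e) :
    pathIntegral φ x u - pathIntegral φ y v ≤ L * (T * e + ∫ s, ‖u s - v s‖ ∂(leb T)) := by
  have huv : Integrable (fun s => ‖u s - v s‖) (leb T) := (hu.sub hv).norm
  rw [pathIntegral, pathIntegral, ← integral_sub (h.integrable hu.1 hxu) (h.integrable hv.1 hyv)]
  calc _ ≤ ∫ s, L * (e + ‖u s - v s‖) ∂(leb T) := by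
        refine integral_mono_ae ((h.integrable hu.1 hxu).sub (h.integrable hv.1 hyv))
          (((integrable_const e).add huv).const_mul L) ?_
        filter_upwards [hxu, hyv] with s h1 h2
        refine (le_abs_self _).trans ((h.lip _ _ h1 h2).trans ?_)
        refine mul_le_mul_of_nonneg_left ?_ h.lip_nonneg
        rw [Prod.mk_sub_mk, Prod.norm_mk]
        exact (max_le_add_of_nonneg (norm_nonneg _) (norm_nonneg _)).trans
          (add_le_add_left (he s) _)
    _ = _ := by
        rw [integral_const_mul, integral_add (integrable_const e) huv, integral_const,
          leb_real_univ hT, smul_eq_mul]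

lemma IsSemiconvexOnBall.pathIntegral_midpoint_le (h : IsSemiconvexOnBall φ M L K) (hT : 0 < T)
    (hu : Integrable u (leb T)) (hv : Integrable v (leb T)) (hw : Integrable w (leb T))
    (huv : Integrable (fun s => ‖u s - v s‖ ^ 2) (leb T))
    (hwuv : ∀ᵐ s ∂(leb T), w s = (1 / 2 : ℝ) • (u s + v s))
    (hxu : ∀ᵐ s ∂(leb T), ‖(x s, u s)‖ ≤ M) (hyv : ∀ᵐ s ∂(leb T), ‖(y s, v s)‖ ≤ M)
    (hzw : ∀ᵐ s ∂(leb T), ‖(z s, w s)‖ ≤ M) {e : ℝ}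
    (he : ∀ s, ‖z s - (1 / 2 : ℝ) • (x s + y s)‖ ≤ e) :
    pathIntegral φ z w ≤ (1 / 2) * (pathIntegral φ x u + pathIntegral φ y v) +
      K * ∫ s, (‖x s - y s‖ ^ 2 + ‖u s - v s‖ ^ 2) ∂(leb T) + L * (T * e) := by
  have hi : Integrable (fun s => ‖x s - y s‖ ^ 2 + ‖u s - v s‖ ^ 2) (leb T) :=
    (integrable_of_continuous (by fun_prop)).add huv
  set c : C(Icc (0 : ℝ) T, Vec n) := (1 / 2 : ℝ) • (x + y) with hc
  have hcs : ∀ s, c s = (1 / 2 : ℝ) • (x s + y s) := fun s => rfl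
  have hcw : ∀ᵐ s ∂(leb T), ‖(c s, w s)‖ ≤ M := by
    filter_upwards [hxu, hyv, hwuv] with s h1 h2 h3
    have e : (c s, w s) = (1 / 2 : ℝ) • ((x s, u s) + (y s, v s)) := by
      rw [hcs, h3, Prod.mk_add_mk, Prod.smul_mk]
    rw [e, ← mem_closedBall_zero_iff]
    exact half_smul_add_mem_of_convex (convex_closedBall (0 : Vec n × Vec m) M)
      (mem_closedBall_zero_iff.2 h1) (mem_closedBall_zero_iff.2 h2)
  have h1 := h.pathIntegral_sub_le hT hw hw hzw hcw he
  simp only [sub_self, norm_zero, integral_zero, add_zero] at h1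
  have h2 : pathIntegral φ c w ≤ (1 / 2) * (pathIntegral φ x u + pathIntegral φ y v) +
      K * ∫ s, (‖x s - y s‖ ^ 2 + ‖u s - v s‖ ^ 2) ∂(leb T) := by
    have hx := h.integrable hu.1 hxu
    have hy := h.integrable hv.1 hyv
    calc pathIntegral φ c w ≤ ∫ s, ((1 / 2) * (φ (x s, u s) + φ (y s, v s)) +
          K * (‖x s - y s‖ ^ 2 + ‖u s - v s‖ ^ 2)) ∂(leb T) := by
          refine integral_mono_ae (h.integrable hw.1 hcw)
            (((hx.add hy).const_mul _).add (hi.const_mul K)) ?_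
          filter_upwards [hxu, hyv, hwuv] with s h1 h2 h3
          have h4 := h.mid _ _ h1 h2
          rw [Prod.mk_add_mk, Prod.smul_mk, ← h3, ← hcs] at h4
          refine h4.trans (add_le_add_right (mul_le_mul_of_nonneg_left ?_ h.mid_nonneg) _)
          rw [Prod.mk_sub_mk, Prod.norm_mk]
          rcases max_cases ‖x s - y s‖ ‖u s - v s‖ with h | h <;> rw [h.1]
          · linarith [sq_nonneg ‖u s - v s‖]
          · linarith [sq_nonneg ‖x s - y s‖]
      _ = _ := by
          rw [integral_add (f := fun s => (1 / 2) * (φ (x s, u s) + φ (y s, v s)))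
            ((hx.add hy).const_mul _) (hi.const_mul K), integral_const_mul, integral_const_mul,
            integral_add hx hy, pathIntegral, pathIntegral]
  linarith

end PathIntegral

/-! ### The quadratic cost -/

/-- The part of the weighted distance that involves the states. -/
def stateCost {T : ℝ} (hT : 0 < T) {n : ℕ} (Q Pf : Matrix (Fin n) (Fin n) ℝ)
    (xd x : C(Icc (0 : ℝ) T, Vec n)) : ℝ :=
  (1 / 2) * (∫ τ, wsq Q (x τ - xd τ) ∂(leb T))
    + (1 / 2) * wsq Pf (x (finalTime hT) - xd (finalTime hT))

/-- The part of the weighted distance that involves the inputs. -/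
def inputCost {T : ℝ} {m : ℕ} (R : Matrix (Fin m) (Fin m) ℝ)
    (ud u : Icc (0 : ℝ) T → Vec m) : ℝ :=
  (1 / 2) * ∫ τ, wsq R (u τ - ud τ) ∂(leb T)

lemma integrable_wsq_sub {T : ℝ} {n : ℕ} (Q : Matrix (Fin n) (Fin n) ℝ)
    (x y : C(Icc (0 : ℝ) T, Vec n)) : Integrable (fun s => wsq Q (x s - y s)) (leb T) :=
  integrable_of_continuous ((continuous_wsq Q).comp (by fun_prop))

lemma stateCost_nonneg {T : ℝ} (hT : 0 < T) {n : ℕ} {Q Pf : Matrix (Fin n) (Fin n) ℝ}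
    (hQ : Q.PosSemidef) (hPf : Pf.PosSemidef) (xd x : C(Icc (0 : ℝ) T, Vec n)) :
    0 ≤ stateCost hT Q Pf xd x := by
  have h1 : 0 ≤ ∫ τ, wsq Q (x τ - xd τ) ∂(leb T) := integral_nonneg fun s => wsq_nonneg hQ _
  have h2 := wsq_nonneg hPf (x (finalTime hT) - xd (finalTime hT))
  unfold stateCost
  linarith

lemma stateCost_midpoint_le {T : ℝ} (hT : 0 < T) {n : ℕ} {Q Pf : Matrix (Fin n) (Fin n) ℝ}
    (hQ : Q.PosSemidef) (hPf : Pf.PosSemidef) (xd x y : C(Icc (0 : ℝ) T, Vec n)) :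
    stateCost hT Q Pf xd ((1 / 2 : ℝ) • (x + y)) ≤
      (1 / 2) * (stateCost hT Q Pf xd x + stateCost hT Q Pf xd y) := by
  have e : ∀ s, ((1 / 2 : ℝ) • (x + y)) s - xd s =
      (1 / 2 : ℝ) • ((x s - xd s) + (y s - xd s)) := fun s => by
    simp only [ContinuousMap.smul_apply, ContinuousMap.add_apply]
    module
  have hx := integrable_wsq_sub Q x xd
  have hy := integrable_wsq_sub Q y xd
  have h1 : ∫ s, wsq Q (((1 / 2 : ℝ) • (x + y)) s - xd s) ∂(leb T) ≤
      ∫ s, (1 / 2) * (wsq Q (x s - xd s) + wsq Q (y s - xd s)) ∂(leb T) := by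
    refine integral_mono (integrable_wsq_sub Q _ _) ((hx.add hy).const_mul _) fun s => ?_
    simp only
    rw [e, wsq_midpoint]
    linarith [wsq_nonneg hQ (x s - xd s - (y s - xd s))]
  rw [integral_const_mul, integral_add hx hy] at h1
  have h2 := wsq_nonneg hPf
    (x (finalTime hT) - xd (finalTime hT) - (y (finalTime hT) - xd (finalTime hT)))
  unfold stateCost
  rw [e, wsq_midpoint]
  linarith

/-- `C` is a constant for which the state cost is `C η`-Lipschitz in the uniform norm on the states
within `η` of the reference. -/
def IsStateCostConst {T : ℝ} (hT : 0 < T) {n : ℕ} (Q Pf : Matrix (Fin n) (Fin n) ℝ) (C : ℝ) :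
    Prop :=
  0 ≤ C ∧ ∀ (xd x y : C(Icc (0 : ℝ) T, Vec n)) (η e : ℝ), (∀ s, ‖x s - xd s‖ ≤ η) →
    (∀ s, ‖y s - xd s‖ ≤ η) → (∀ s, ‖x s - y s‖ ≤ e) →
    stateCost hT Q Pf xd x - stateCost hT Q Pf xd y ≤ C * η * e

lemma exists_isStateCostConst {T : ℝ} (hT : 0 < T) {n : ℕ} (Q Pf : Matrix (Fin n) (Fin n) ℝ) :
    ∃ C, IsStateCostConst hT Q Pf C := by
  obtain ⟨C₁, hC₁0, hC₁⟩ := exists_abs_wsq_sub_le Q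
  obtain ⟨C₂, hC₂0, hC₂⟩ := exists_abs_wsq_sub_le Pf
  refine ⟨T * C₁ + C₂, by positivity, fun xd x y η e hx hy hxy => ?_⟩
  have he : 0 ≤ e := (norm_nonneg _).trans (hxy (finalTime hT))
  have key : ∀ (A : Matrix (Fin n) (Fin n) ℝ) (C : ℝ), 0 ≤ C →
      (∀ a b : Vec n, |wsq A a - wsq A b| ≤ C * ‖a - b‖ * (‖a‖ + ‖b‖)) →
      ∀ s, wsq A (x s - xd s) - wsq A (y s - xd s) ≤ 2 * (C * η * e) := fun A C hC h s => by
    refine (le_abs_self _).trans ((h _ _).trans ?_)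
    rw [sub_sub_sub_cancel_right]
    have h1 : ‖x s - xd s‖ + ‖y s - xd s‖ ≤ 2 * η := by linarith [hx s, hy s]
    calc _ ≤ C * e * (2 * η) := by
          gcongr
          exact hxy s
      _ = _ := by ring
  have h1 : ∫ s, (wsq Q (x s - xd s) - wsq Q (y s - xd s)) ∂(leb T) ≤
      ∫ s, 2 * (C₁ * η * e) ∂(leb T) :=
    integral_mono ((integrable_wsq_sub Q _ _).sub (integrable_wsq_sub Q _ _)) (integrable_const _)
      (key Q C₁ hC₁0 hC₁)
  rw [integral_sub (integrable_wsq_sub Q _ _) (integrable_wsq_sub Q _ _), integral_const,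
    leb_real_univ hT, smul_eq_mul] at h1
  have h2 := key Pf C₂ hC₂0 hC₂ (finalTime hT)
  unfold stateCost
  linarith

/-! ### Inputs in an `L∞` ball -/

/-- The measurable inputs within `L∞` distance `r` of `ud`. -/
def IsNear {T : ℝ} {m : ℕ} (ud : Icc (0 : ℝ) T → Vec m) (r : ℝ) (u : Icc (0 : ℝ) T → Vec m) :
    Prop :=
  AEStronglyMeasurable u (leb T) ∧ ∀ᵐ s ∂(leb T), ‖u s - ud s‖ ≤ r

section IsNear

variable {T : ℝ} {m : ℕ} {ud u v w : Icc (0 : ℝ) T → Vec m} {r : ℝ}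

lemma IsNear.integrable (hud : Integrable ud (leb T)) (hu : IsNear ud r u) :
    Integrable u (leb T) := by
  have : Integrable (u - ud) (leb T) := .of_bound (hu.1.sub hud.1) r hu.2
  simpa using this.add hud

lemma IsNear.integrable_sq (hu : IsNear ud r u) (hv : IsNear ud r v) :
    Integrable (fun s => ‖u s - v s‖ ^ 2) (leb T) := by
  refine .of_bound ((hu.1.sub hv.1).norm.pow 2) ((2 * r) ^ 2) ?_
  filter_upwards [hu.2, hv.2] with s h1 h2
  rw [Real.norm_eq_abs, abs_pow, abs_norm]
  refine pow_le_pow_left₀ (norm_nonneg _) ?_ 2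
  have := norm_sub_le_norm_sub_add_norm_sub (u s) (ud s) (v s)
  rw [norm_sub_rev (ud s)] at this
  linarith

lemma IsNear.integrable_wsq (hud : AEStronglyMeasurable ud (leb T)) (hu : IsNear ud r u)
    (R : Matrix (Fin m) (Fin m) ℝ) : Integrable (fun s => wsq R (u s - ud s)) (leb T) := by
  obtain ⟨C, hC0, hC⟩ := exists_abs_wsq_sub_le R
  refine .of_bound ((continuous_wsq R).comp_aestronglyMeasurable (hu.1.sub hud)) (C * r * r) ?_
  filter_upwards [hu.2] with s h1
  have h2 := hC (u s - ud s) 0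
  rw [wsq_zero, sub_zero, sub_zero, norm_zero, add_zero] at h2
  have hr : 0 ≤ r := (norm_nonneg _).trans h1
  exact h2.trans (by gcongr)

lemma IsNear.integral_norm_sub_le (hT : 0 < T) (hud : Integrable ud (leb T))
    (hu : IsNear ud r u) : ∫ s, ‖u s - ud s‖ ∂(leb T) ≤ T * r := by
  have h := integral_mono_ae ((hu.integrable hud).sub hud).norm (integrable_const r) hu.2
  rwa [integral_const, leb_real_univ hT, smul_eq_mul] at h

lemma IsNear.midpoint (hu : IsNear ud r u) (hv : IsNear ud r v)
    (hw : AEStronglyMeasurable w (leb T))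
    (hwuv : ∀ᵐ s ∂(leb T), w s = (1 / 2 : ℝ) • (u s + v s)) : IsNear ud r w := by
  refine ⟨hw, ?_⟩
  filter_upwards [hu.2, hv.2, hwuv] with s h1 h2 h3
  rw [h3, ← dist_eq_norm, ← Metric.mem_closedBall]
  rw [← dist_eq_norm, ← Metric.mem_closedBall] at h1 h2
  exact half_smul_add_mem_of_convex (convex_closedBall _ _) h1 h2

lemma inputCost_midpoint_le (hud : AEStronglyMeasurable ud (leb T)) (hu : IsNear ud r u)
    (hv : IsNear ud r v) (hw : IsNear ud r w)
    (hwuv : ∀ᵐ s ∂(leb T), w s = (1 / 2 : ℝ) • (u s + v s)) {R : Matrix (Fin m) (Fin m) ℝ} {c : ℝ}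
    (hR : ∀ a : Vec m, c * ‖a‖ ^ 2 ≤ wsq R a) :
    inputCost R ud w ≤ (1 / 2) * (inputCost R ud u + inputCost R ud v) -
      c / 8 * ∫ s, ‖u s - v s‖ ^ 2 ∂(leb T) := by
  have hiu := hu.integrable_wsq hud R
  have hiv := hv.integrable_wsq hud R
  have hi := hu.integrable_sq hv
  have h : ∫ s, wsq R (w s - ud s) ∂(leb T) ≤
      ∫ s, ((1 / 2) * (wsq R (u s - ud s) + wsq R (v s - ud s)) - c / 4 * ‖u s - v s‖ ^ 2)
        ∂(leb T) := by
    refine integral_mono_ae (hw.integrable_wsq hud R)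
      (((hiu.add hiv).const_mul _).sub (hi.const_mul _)) ?_
    filter_upwards [hwuv] with s hs
    have e : w s - ud s = (1 / 2 : ℝ) • ((u s - ud s) + (v s - ud s)) := by rw [hs]; module
    rw [e, wsq_midpoint, sub_sub_sub_cancel_right]
    linarith [hR (u s - v s)]
  rw [integral_sub (f := fun s => (1 / 2) * (wsq R (u s - ud s) + wsq R (v s - ud s)))
    ((hiu.add hiv).const_mul _) (hi.const_mul _), integral_const_mul, integral_const_mul,
    integral_add hiu hiv] at h
  unfold inputCost
  linarith

lemma exists_inputCost_sub_le (R : Matrix (Fin m) (Fin m) ℝ) :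
    ∃ C, 0 ≤ C ∧ ∀ (T r : ℝ) (ud u v : Icc (0 : ℝ) T → Vec m), Integrable ud (leb T) →
      IsNear ud r u → IsNear ud r v →
      inputCost R ud u - inputCost R ud v ≤ C * r * ∫ s, ‖u s - v s‖ ∂(leb T) := by
  obtain ⟨C, hC0, hC⟩ := exists_abs_wsq_sub_le R
  refine ⟨C, hC0, fun T r ud u v hud hu hv => ?_⟩
  have h : ∫ s, (wsq R (u s - ud s) - wsq R (v s - ud s)) ∂(leb T) ≤
      ∫ s, 2 * (C * r) * ‖u s - v s‖ ∂(leb T) := by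
    refine integral_mono_ae ((hu.integrable_wsq hud.1 R).sub (hv.integrable_wsq hud.1 R))
      (((hu.integrable hud).sub (hv.integrable hud)).norm.const_mul _) ?_
    filter_upwards [hu.2, hv.2] with s h1 h2
    refine (le_abs_self _).trans ((hC _ _).trans ?_)
    rw [sub_sub_sub_cancel_right]
    calc _ ≤ C * ‖u s - v s‖ * (r + r) := by gcongr
      _ = _ := by ring
  rw [integral_sub (hu.integrable_wsq hud.1 R) (hv.integrable_wsq hud.1 R),
    integral_const_mul] at h
  unfold inputCost
  linarith

end IsNear

/-! ### The reduced problem near the desired trajectory -/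

/-- A tame control system, an integrand `φ`, a reference trajectory `(xd, ud)` and a radius `r` so
small that inputs within `r` of `ud` produce curves that stay in the ball of radius `M` on which
`φ` is controlled. -/
structure LocalSetting {T : ℝ} {n m : ℕ} (F : Vec n × Vec m → Vec n) (L K : ℝ) (x₀ : Vec n)
    (φ : Vec n × Vec m → ℝ) (M Lφ Kφ : ℝ) (xd : C(Icc (0 : ℝ) T, Vec n))
    (ud : Icc (0 : ℝ) T → Vec m) (r : ℝ) : Prop where
  time_pos : 0 < T
  tame : IsTame F L K
  semiconvex : IsSemiconvexOnBall φ M Lφ Kφ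
  isSol : IsSol F x₀ xd ud
  integrable : Integrable ud (leb T)
  state_le : ∀ s, ‖xd s‖ + 1 ≤ M
  input_le : ∀ᵐ s ∂(leb T), ‖ud s‖ + 1 ≤ M
  radius_pos : 0 < r
  radius_le : (gronwallConst T L * L * T + 1) * r ≤ 1

/-- The cost of a curve: weighted distance to the reference plus `ε` times the integral of `φ`. -/
def cost {T : ℝ} (hT : 0 < T) {n m : ℕ} (Q Pf : Matrix (Fin n) (Fin n) ℝ)
    (R : Matrix (Fin m) (Fin m) ℝ) (φ : Vec n × Vec m → ℝ) (ε : ℝ)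
    (xd : C(Icc (0 : ℝ) T, Vec n)) (ud : Icc (0 : ℝ) T → Vec m) (x : C(Icc (0 : ℝ) T, Vec n))
    (u : Icc (0 : ℝ) T → Vec m) : ℝ :=
  stateCost hT Q Pf xd x + inputCost R ud u + ε * pathIntegral φ x u

namespace LocalSetting

variable {T : ℝ} {n m : ℕ} {F : Vec n × Vec m → Vec n} {L K : ℝ} {x₀ : Vec n}
  {φ : Vec n × Vec m → ℝ} {M Lφ Kφ : ℝ} {xd : C(Icc (0 : ℝ) T, Vec n)}
  {ud : Icc (0 : ℝ) T → Vec m} {r : ℝ}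
  {Q Pf : Matrix (Fin n) (Fin n) ℝ} {R : Matrix (Fin m) (Fin m) ℝ} {CS c ε : ℝ}
  {x y z : C(Icc (0 : ℝ) T, Vec n)} {u v w : Icc (0 : ℝ) T → Vec m}

lemma lip_nonneg (h : LocalSetting F L K x₀ φ M Lφ Kφ xd ud r) : 0 ≤ gronwallConst T L * L :=
  mul_nonneg (gronwallConst_pos T L).le h.tame.lip_nonneg

lemma norm_state_sub_le (h : LocalSetting F L K x₀ φ M Lφ Kφ xd ud r) (hu : IsNear ud r u)
    (hx : IsSol F x₀ x u) (s : Icc (0 : ℝ) T) :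
    ‖x s - xd s‖ ≤ gronwallConst T L * L * (T * r) :=
  (h.tame.norm_sub_le h.time_pos hx h.isSol (hu.integrable h.integrable) h.integrable s).trans
    (mul_le_mul_of_nonneg_left (hu.integral_norm_sub_le h.time_pos h.integrable) h.lip_nonneg)

lemma norm_le (h : LocalSetting F L K x₀ φ M Lφ Kφ xd ud r) (hu : IsNear ud r u)
    (hx : IsSol F x₀ x u) : ∀ᵐ s ∂(leb T), ‖(x s, u s)‖ ≤ M := by
  have h1 := h.radius_le
  have h2 : 0 ≤ gronwallConst T L * L * T * r :=
    mul_nonneg (mul_nonneg h.lip_nonneg h.time_pos.le) h.radius_pos.le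
  filter_upwards [hu.2, h.input_le] with s h3 h4
  rw [Prod.norm_mk]
  refine max_le ?_ ?_
  · have := norm_le_norm_add_norm_sub' (x s) (xd s)
    linarith [h.norm_state_sub_le hu hx s, h.state_le s, h.radius_pos]
  · have := norm_le_norm_add_norm_sub' (u s) (ud s)
    linarith

lemma isNear_self (h : LocalSetting F L K x₀ φ M Lφ Kφ xd ud r) : IsNear ud r ud :=
  ⟨h.integrable.1, .of_forall fun s => by simpa using h.radius_pos.le⟩

/-- Along trajectories the integral of `φ` is Lipschitz in the `L¹` norm of the input. -/
lemma pathIntegral_sub_le (h : LocalSetting F L K x₀ φ M Lφ Kφ xd ud r) (hu : IsNear ud r u)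
    (hv : IsNear ud r v) (hx : IsSol F x₀ x u) (hy : IsSol F x₀ y v) :
    pathIntegral φ x u - pathIntegral φ y v ≤
      Lφ * (T * (gronwallConst T L * L) + 1) * ∫ s, ‖u s - v s‖ ∂(leb T) := by
  have hu' := hu.integrable h.integrable
  have hv' := hv.integrable h.integrable
  refine (h.semiconvex.pathIntegral_sub_le h.time_pos hu' hv' (h.norm_le hu hx) (h.norm_le hv hy)
    (h.tame.norm_sub_le h.time_pos hx hy hu' hv')).trans (le_of_eq ?_)
  ring

lemma exists_cost_sub_le (h : LocalSetting F L K x₀ φ M Lφ Kφ xd ud r)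
    (Q Pf : Matrix (Fin n) (Fin n) ℝ) (R : Matrix (Fin m) (Fin m) ℝ) (hε : 0 ≤ ε) :
    ∃ C, 0 ≤ C ∧ ∀ x y u v, IsNear ud r u → IsNear ud r v → IsSol F x₀ x u → IsSol F x₀ y v →
      cost h.time_pos Q Pf R φ ε xd ud x u - cost h.time_pos Q Pf R φ ε xd ud y v ≤
        C * ∫ s, ‖u s - v s‖ ∂(leb T) := by
  obtain ⟨CS, hCS0, hCS⟩ := exists_isStateCostConst h.time_pos Q Pf
  obtain ⟨CR, hCR0, hCR⟩ := exists_inputCost_sub_le R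
  have hG := h.lip_nonneg
  have hT := h.time_pos
  have hr := h.radius_pos
  have hLφ := h.semiconvex.lip_nonneg
  refine ⟨CS * (gronwallConst T L * L * (T * r)) * (gronwallConst T L * L) + CR * r +
    ε * (Lφ * (T * (gronwallConst T L * L) + 1)), by positivity, fun x y u v hu hv hx hy => ?_⟩
  have h1 := hCS xd x y _ _ (h.norm_state_sub_le hu hx) (h.norm_state_sub_le hv hy)
    (h.tame.norm_sub_le hT hx hy (hu.integrable h.integrable) (hv.integrable h.integrable))
  have h2 := hCR T r ud u v h.integrable hu hv
  have h3 := mul_le_mul_of_nonneg_left (h.pathIntegral_sub_le hu hv hx hy) hε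
  unfold cost
  linarith

/-- Strong midpoint convexity of the reduced cost in the `L²` norm of the input: the convexity
`c / 8` of the input cost dominates the errors due to the curvature of the dynamics, small with
`r`, and of the integrand, small with `ε`. -/
lemma cost_midpoint_le (h : LocalSetting F L K x₀ φ M Lφ Kφ xd ud r) (hQ : Q.PosSemidef)
    (hPf : Pf.PosSemidef) (hR : ∀ a : Vec m, c * ‖a‖ ^ 2 ≤ wsq R a)
    (hCS : IsStateCostConst h.time_pos Q Pf CS) (hε : 0 ≤ ε)
    (hcr : CS * (gronwallConst T L * L * (T * r)) *
      (gronwallConst T L * (K * sqConst T L)) ≤ c / 32)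
    (hcε : ε * (Kφ * sqConst T L + Lφ * (T * (gronwallConst T L * (K * sqConst T L)))) ≤ c / 32)
    (hu : IsNear ud r u) (hv : IsNear ud r v) (hw : AEStronglyMeasurable w (leb T))
    (hwuv : ∀ᵐ s ∂(leb T), w s = (1 / 2 : ℝ) • (u s + v s))
    (hx : IsSol F x₀ x u) (hy : IsSol F x₀ y v) (hz : IsSol F x₀ z w) :
    cost h.time_pos Q Pf R φ ε xd ud z w ≤
      (1 / 2) * (cost h.time_pos Q Pf R φ ε xd ud x u + cost h.time_pos Q Pf R φ ε xd ud y v) -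
        c / 16 * ∫ s, ‖u s - v s‖ ^ 2 ∂(leb T) := by
  have hT := h.time_pos
  have hwn : IsNear ud r w := hu.midpoint hv hw hwuv
  have hu' := hu.integrable h.integrable
  have hv' := hv.integrable h.integrable
  have hi := hu.integrable_sq hv
  set I := ∫ s, ‖u s - v s‖ ^ 2 ∂(leb T) with hI
  have hI0 : 0 ≤ I := integral_nonneg fun s => by positivity
  have he := h.tame.norm_sub_midpoint_le hT hx hy hz hu' hv' hw hi hwuv
  have hc : ∀ s, ‖((1 / 2 : ℝ) • (x + y)) s - xd s‖ ≤ gronwallConst T L * L * (T * r) :=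
    fun s => by
      rw [← dist_eq_norm, ← Metric.mem_closedBall]
      refine half_smul_add_mem_of_convex (convex_closedBall _ _) ?_ ?_ <;>
        rw [Metric.mem_closedBall, dist_eq_norm]
      exacts [h.norm_state_sub_le hu hx s, h.norm_state_sub_le hv hy s]
  have h1 := hCS.2 xd z ((1 / 2 : ℝ) • (x + y)) _ _ (h.norm_state_sub_le hwn hz) hc he
  have h2 := stateCost_midpoint_le hT hQ hPf xd x y
  have h3 := inputCost_midpoint_le h.integrable.1 hu hv hwn hwuv hR
  have h4 := h.semiconvex.pathIntegral_midpoint_le hT hu' hv' (hwn.integrable h.integrable) hi hwuv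
    (h.norm_le hu hx) (h.norm_le hv hy) (h.norm_le hwn hz) he
  have h5 := mul_le_mul_of_nonneg_left (h.tame.integral_sq_le hT hx hy hu' hv' hi)
    h.semiconvex.mid_nonneg
  have h6 := mul_le_mul_of_nonneg_left (h4.trans (add_le_add_left (add_le_add_right h5 _) _)) hε
  have h7 := mul_le_mul_of_nonneg_right hcr hI0
  have h8 := mul_le_mul_of_nonneg_right hcε hI0
  rw [← hI] at h3 h6 h1
  unfold cost
  nlinarith

end LocalSetting

/-- Direct method without compactness: minimizing sequences of a strongly midpoint-convex function
are Cauchy. -/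
lemma exists_minimizer_of_strong_midpoint {X : Type*} [NormedAddCommGroup X] [NormedSpace ℝ X]
    [CompleteSpace X] {S : Set X} (hS : IsClosed S) (hne : S.Nonempty)
    (hmid : ∀ u ∈ S, ∀ v ∈ S, (1 / 2 : ℝ) • (u + v) ∈ S) {J : X → ℝ} (hJ : ContinuousOn J S)
    {b : ℝ} (hb : ∀ u ∈ S, b ≤ J u) {κ : ℝ} (hκ : 0 < κ)
    (hJmid : ∀ u ∈ S, ∀ v ∈ S,
      J ((1 / 2 : ℝ) • (u + v)) ≤ (1 / 2) * (J u + J v) - κ * ‖u - v‖ ^ 2) :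
    ∃ u ∈ S, ∀ v ∈ S, J u ≤ J v := by
  have hbdd : BddBelow (J '' S) := ⟨b, by rintro _ ⟨u, hu, rfl⟩; exact hb u hu⟩
  set μ := sInf (J '' S) with hμ
  have hle : ∀ u ∈ S, μ ≤ J u := fun u hu => csInf_le hbdd (mem_image_of_mem J hu)
  have hex : ∀ i : ℕ, ∃ u ∈ S, J u < μ + 1 / ((i : ℝ) + 1) := fun i => by
    obtain ⟨_, ⟨u, hu, rfl⟩, h⟩ := exists_lt_of_csInf_lt (hne.image J)
      (lt_add_of_pos_right μ (Nat.one_div_pos_of_nat (n := i)))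
    exact ⟨u, hu, h⟩
  choose a haS ha using hex
  have hdist : ∀ i j l : ℕ, l ≤ i → l ≤ j → ‖a i - a j‖ ^ 2 ≤ κ⁻¹ * (1 / ((l : ℝ) + 1)) :=
    fun i j l hi hj => by
      have h1 := hJmid _ (haS i) _ (haS j)
      have h2 := hle _ (hmid _ (haS i) _ (haS j))
      have h3 := (ha i).le.trans (add_le_add_right (Nat.one_div_le_one_div (α := ℝ) hi) μ)
      have h4 := (ha j).le.trans (add_le_add_right (Nat.one_div_le_one_div (α := ℝ) hj) μ)
      rw [le_inv_mul_iff₀ hκ]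
      linarith
  have hcau : CauchySeq a := by
    refine cauchySeq_of_le_tendsto_0 (fun l : ℕ => √(κ⁻¹ * (1 / ((l : ℝ) + 1)))) (fun i j l hi hj =>
      by rw [dist_eq_norm]; exact Real.le_sqrt_of_sq_le (hdist i j l hi hj)) ?_
    have := (tendsto_one_div_add_atTop_nhds_zero_nat (𝕜 := ℝ)).const_mul κ⁻¹
    simpa using this.sqrt
  obtain ⟨u, hu⟩ := cauchySeq_tendsto_of_complete hcau
  have huS : u ∈ S := hS.mem_of_tendsto hu (.of_forall haS)
  refine ⟨u, huS, fun v hv => le_trans ?_ (hle v hv)⟩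
  have hJu : Filter.Tendsto (fun i => J (a i)) Filter.atTop (𝓝 (J u)) :=
    (hJ u huS).tendsto.comp (tendsto_nhdsWithin_iff.2 ⟨hu, .of_forall haS⟩)
  have hlim := (tendsto_one_div_add_atTop_nhds_zero_nat (𝕜 := ℝ)).const_add μ
  rw [add_zero] at hlim
  exact le_of_tendsto_of_tendsto' hJu hlim fun i => (ha i).le

/-- An `L∞` ball is closed in `L¹`. -/
lemma isClosed_setOf_isNear {T : ℝ} {m : ℕ} (ud : Icc (0 : ℝ) T → Vec m) (r : ℝ) :
    IsClosed {u : Lp (Vec m) 1 (leb T) | IsNear ud r u} := by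
  refine IsSeqClosed.isClosed fun a u ha hu => ⟨Lp.aestronglyMeasurable u, ?_⟩
  obtain ⟨ns, -, hns⟩ := (tendstoInMeasure_of_tendsto_Lp hu).exists_seq_tendsto_ae
  filter_upwards [hns, ae_all_iff.2 fun i => (ha i).2] with s h1 h2
  exact le_of_tendsto' (h1.sub_const (ud s)).norm fun i => h2 (ns i)

lemma norm_sub_L1_eq {T : ℝ} {m : ℕ} (u v : Lp (Vec m) 1 (leb T)) :
    ‖u - v‖ = ∫ s, ‖u s - v s‖ ∂(leb T) := by
  rw [L1.norm_eq_integral_norm]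
  refine integral_congr_ae ?_
  filter_upwards [Lp.coeFn_sub u v] with s hs
  rw [hs, Pi.sub_apply]

namespace LocalSetting

variable {T : ℝ} {n m : ℕ} {F : Vec n × Vec m → Vec n} {L K : ℝ} {x₀ : Vec n}
  {φ : Vec n × Vec m → ℝ} {M Lφ Kφ : ℝ} {xd : C(Icc (0 : ℝ) T, Vec n)}
  {ud : Icc (0 : ℝ) T → Vec m} {r : ℝ}
  {Q Pf : Matrix (Fin n) (Fin n) ℝ} {R : Matrix (Fin m) (Fin m) ℝ} {CS c ε : ℝ}
  {x y z : C(Icc (0 : ℝ) T, Vec n)} {u v w : Icc (0 : ℝ) T → Vec m}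

lemma exists_minimizer (h : LocalSetting F L K x₀ φ M Lφ Kφ xd ud r) (hQ : Q.PosSemidef)
    (hPf : Pf.PosSemidef) (hc : 0 < c) (hR : ∀ a : Vec m, c * ‖a‖ ^ 2 ≤ wsq R a)
    (hCS : IsStateCostConst h.time_pos Q Pf CS) (hε : 0 ≤ ε)
    (hcr : CS * (gronwallConst T L * L * (T * r)) *
      (gronwallConst T L * (K * sqConst T L)) ≤ c / 32)
    (hcε : ε * (Kφ * sqConst T L + Lφ * (T * (gronwallConst T L * (K * sqConst T L)))) ≤ c / 32) :
    ∃ x u, IsNear ud r u ∧ IsSol F x₀ x u ∧ ∀ y v, IsNear ud r v → IsSol F x₀ y v →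
      cost h.time_pos Q Pf R φ ε xd ud x u ≤ cost h.time_pos Q Pf R φ ε xd ud y v := by
  have hT := h.time_pos
  obtain ⟨CL, hCL0, hCL⟩ := h.exists_cost_sub_le Q Pf R hε
  choose X hX using fun u : Lp (Vec m) 1 (leb T) =>
    h.tame.exists_isSol hT x₀ (Lp.aestronglyMeasurable u)
  set S : Set (Lp (Vec m) 1 (leb T)) := {u | IsNear ud r u} with hS
  set J : Lp (Vec m) 1 (leb T) → ℝ := fun u => cost hT Q Pf R φ ε xd ud (X u) u with hJ
  have hlip : ∀ u ∈ S, ∀ v ∈ S, J u - J v ≤ CL * ‖u - v‖ := fun u hu v hv => by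
    rw [norm_sub_L1_eq]
    exact hCL _ _ _ _ hu hv (hX u) (hX v)
  have htoL1 : ∀ v, IsNear ud r v → ∃ v' ∈ S, v' =ᵐ[leb T] v := fun v hv => by
    have hv1 := memLp_one_iff_integrable.2 (hv.integrable h.integrable)
    refine ⟨hv1.toLp v, ⟨Lp.aestronglyMeasurable _, ?_⟩, hv1.coeFn_toLp⟩
    filter_upwards [hv1.coeFn_toLp, hv.2] with s h1 h2
    rwa [h1]
  obtain ⟨d, hdS, -⟩ := htoL1 ud h.isNear_self
  obtain ⟨u, hu, hmin⟩ : ∃ u ∈ S, ∀ v ∈ S, J u ≤ J v := by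
    refine exists_minimizer_of_strong_midpoint (S := S) (J := J)
      (b := J d - CL * (2 * (T * r))) (κ := c / 16 / T)
      (isClosed_setOf_isNear ud r) ⟨d, hdS⟩ (fun u hu v hv => ?_) ?_ (fun u hu => ?_) (by positivity)
      (fun u hu v hv => ?_)
    · refine hu.midpoint hv (Lp.aestronglyMeasurable _) ?_
      filter_upwards [Lp.coeFn_smul (1 / 2 : ℝ) (u + v), Lp.coeFn_add u v] with s h1 h2
      rw [h1, Pi.smul_apply, h2, Pi.add_apply]
    · refine (LipschitzOnWith.of_dist_le_mul (K := CL.toNNReal) fun u hu v hv => ?_).continuousOn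
      rw [Real.dist_eq, dist_eq_norm, Real.coe_toNNReal _ hCL0, abs_le]
      have h1 := hlip u hu v hv
      have h2 := hlip v hv u hu
      rw [norm_sub_rev] at h2
      constructor <;> linarith
    · have h1 := hlip d hdS u hu
      have h2 : ‖d - u‖ ≤ 2 * (T * r) := by
        rw [norm_sub_L1_eq]
        have := integral_mono_ae
          ((hdS.integrable h.integrable).sub (hu.integrable h.integrable)).norm
          (integrable_const (2 * r)) (by
            filter_upwards [hdS.2, hu.2] with s h1 h2
            have := norm_sub_le_norm_sub_add_norm_sub (d s) (ud s) (u s)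
            rw [norm_sub_rev (ud s)] at this
            simp only [Pi.sub_apply]
            linarith)
        rw [integral_const, leb_real_univ hT, smul_eq_mul] at this
        simp only [Pi.sub_apply] at this
        linarith
      have := mul_le_mul_of_nonneg_left h2 hCL0
      linarith
    · have hw : ∀ᵐ s ∂(leb T), ((1 / 2 : ℝ) • (u + v) : Lp (Vec m) 1 (leb T)) s =
          (1 / 2 : ℝ) • (u s + v s) := by
        filter_upwards [Lp.coeFn_smul (1 / 2 : ℝ) (u + v), Lp.coeFn_add u v] with s h1 h2
        rw [h1, Pi.smul_apply, h2, Pi.add_apply]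
      refine (h.cost_midpoint_le hQ hPf hR hCS hε hcr hcε hu hv (Lp.aestronglyMeasurable _) hw
        (hX u) (hX v) (hX _)).trans (sub_le_sub_left ?_ _)
      have h1 := sq_integral_le hT
        ((hu.integrable h.integrable).sub (hv.integrable h.integrable)).norm (hu.integrable_sq hv)
      rw [norm_sub_L1_eq, div_mul_eq_mul_div, div_le_iff₀ hT, mul_assoc]
      refine mul_le_mul_of_nonneg_left ?_ (by positivity)
      rw [mul_comm]
      exact h1
  refine ⟨X u, u, hu, hX u, fun y v hv hy => ?_⟩
  obtain ⟨v', hv'S, hv'⟩ := htoL1 v hv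
  refine (hmin v' hv'S).trans (sub_nonpos.1 ((hCL _ _ _ _ hv'S hv (hX v') hy).trans ?_))
  rw [integral_eq_zero_of_ae (by filter_upwards [hv'] with s hs; simp [hs]), mul_zero]

/-- A minimizer over the `L∞` ball lies strictly inside it: otherwise, replacing its input by `ud`
wherever the two differ by more than `r / 2` would decrease the cost. The gain in the input cost
is of order `r` times the `L¹` size of the change, whereas the state cost and the integral of `φ`
change by at most `O(ε)` times that size. -/
lemma norm_sub_le_half_of_isMin (h : LocalSetting F L K x₀ φ M Lφ Kφ xd ud r) (hQ : Q.PosSemidef)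
    (hPf : Pf.PosSemidef) (hc : 0 < c) (hR : ∀ a : Vec m, c * ‖a‖ ^ 2 ≤ wsq R a)
    (hCS : IsStateCostConst h.time_pos Q Pf CS) (hε : 0 ≤ ε)
    (hcε : ε * (Lφ * (T * (gronwallConst T L * L) + 1) *
      (CS * (gronwallConst T L * L) ^ 2 * (2 * T / c) + 1)) ≤ c * r / 8)
    (hu : IsNear ud r u) (hx : IsSol F x₀ x u)
    (hmin : ∀ y v, IsNear ud r v → IsSol F x₀ y v →
      cost h.time_pos Q Pf R φ ε xd ud x u ≤ cost h.time_pos Q Pf R φ ε xd ud y v) :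
    ∀ᵐ s ∂(leb T), ‖u s - ud s‖ ≤ r / 2 := by
  have hT := h.time_pos
  have hr := h.radius_pos
  have hG := h.lip_nonneg
  have hLφ := h.semiconvex.lip_nonneg
  have hu' := hu.integrable h.integrable
  have hud := h.integrable
  set G := gronwallConst T L * L with hGdef
  set Λ := Lφ * (T * G + 1) with hΛ
  have hΛ0 : 0 ≤ Λ := by positivity
  set d := ∫ s, ‖u s - ud s‖ ∂(leb T) with hd
  have hd0 : 0 ≤ d := integral_nonneg fun s => norm_nonneg _
  -- comparison with the reference: the minimizer is `O(ε)`-close to `ud` in `L¹`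
  have hdε : d ≤ 2 * T / c * (ε * Λ) := by
    have h1 := hmin xd ud h.isNear_self h.isSol
    have h2 : stateCost hT Q Pf xd xd = 0 := by simp [stateCost, wsq_zero]
    have h3 : inputCost R ud ud = 0 := by simp [inputCost, wsq_zero]
    have h4 := stateCost_nonneg hT hQ hPf xd x
    have h5 := mul_le_mul_of_nonneg_left (h.pathIntegral_sub_le h.isNear_self hu h.isSol hx) hε
    have h6 : ∫ s, ‖ud s - u s‖ ∂(leb T) = d := integral_congr_ae (.of_forall fun s => norm_sub_rev _ _)
    rw [h6] at h5
    have hi := hu.integrable_sq h.isNear_self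
    have h7 : c * ∫ s, ‖u s - ud s‖ ^ 2 ∂(leb T) ≤ ∫ s, wsq R (u s - ud s) ∂(leb T) := by
      rw [← integral_const_mul]
      exact integral_mono (hi.const_mul c) (hu.integrable_wsq hud.1 R) fun s => hR _
    have h8 := sq_integral_le hT (hu'.sub hud).norm hi
    have h9 : d ^ 2 ≤ T * ∫ s, ‖u s - ud s‖ ^ 2 ∂(leb T) := h8
    unfold cost at h1
    rw [h2, h3] at h1
    have h10 : inputCost R ud u = (1 / 2) * ∫ s, wsq R (u s - ud s) ∂(leb T) := rfl
    have h11 : c * d ^ 2 ≤ 2 * T * (ε * Λ) * d := by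
      have h12 := mul_le_mul_of_nonneg_left h9 hc.le
      have h13 : T * (c * ∫ s, ‖u s - ud s‖ ^ 2 ∂(leb T)) ≤ T * (2 * (ε * Λ * d)) := by
        refine mul_le_mul_of_nonneg_left ?_ hT.le
        simp only [← hGdef, ← hΛ] at h5
        linarith
      linarith
    rcases hd0.eq_or_lt with h0 | hpos
    · rw [← h0]; positivity
    · have h12 : c * d ≤ 2 * T * (ε * Λ) := by
        refine le_of_mul_le_mul_right ?_ hpos
        linarith
      rw [div_mul_eq_mul_div, le_div_iff₀ hc]
      linarith
  -- replace the input by `ud` where it is farther than `r / 2` from it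
  obtain ⟨u₁, hu₁m, hu₁⟩ := hu.1.sub hud.1
  set E : Set (Icc (0 : ℝ) T) := {s | r / 2 < ‖u₁ s‖} with hE
  have hEm : MeasurableSet E := measurableSet_lt measurable_const hu₁m.norm.measurable
  classical
  set v : Icc (0 : ℝ) T → Vec m := E.piecewise ud u with hv
  have hvm : AEStronglyMeasurable v (leb T) :=
    AEStronglyMeasurable.piecewise hEm hud.1.restrict hu.1.restrict
  have hcase : ∀ᵐ s ∂(leb T), (r / 2 < ‖u s - ud s‖ ∧ v s = ud s) ∨
      (‖u s - ud s‖ ≤ r / 2 ∧ v s = u s) := by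
    filter_upwards [hu₁] with s hs
    rw [Pi.sub_apply] at hs
    by_cases hsE : s ∈ E
    · exact Or.inl ⟨by rw [hs]; exact hsE, piecewise_eq_of_mem _ _ _ hsE⟩
    · exact Or.inr ⟨by rw [hs]; exact not_lt.1 hsE, piecewise_eq_of_notMem _ _ _ hsE⟩
  have hvd : ∀ᵐ s ∂(leb T), ‖v s - ud s‖ ≤ ‖u s - ud s‖ := by
    filter_upwards [hcase] with s hs
    rcases hs with ⟨-, h2⟩ | ⟨-, h2⟩ <;> simp [h2]
  have hvn : IsNear ud r v := ⟨hvm, by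
    filter_upwards [hvd, hu.2] with s h1 h2 using h1.trans h2⟩
  have hv' := hvn.integrable hud
  obtain ⟨y, hy⟩ := h.tame.exists_isSol hT x₀ hvm
  set a := ∫ s, ‖v s - u s‖ ∂(leb T) with ha
  have ha0 : 0 ≤ a := integral_nonneg fun s => norm_nonneg _
  have hxη : ∀ s, ‖x s - xd s‖ ≤ G * d := h.tame.norm_sub_le hT hx h.isSol hu' hud
  have hyη : ∀ s, ‖y s - xd s‖ ≤ G * d := fun s =>
    (h.tame.norm_sub_le hT hy h.isSol hv' hud s).trans
      (mul_le_mul_of_nonneg_left (integral_mono_ae (hv'.sub hud).norm (hu'.sub hud).norm hvd) hG)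
  have hyx : ∀ s, ‖y s - x s‖ ≤ G * a := h.tame.norm_sub_le hT hy hx hv' hu'
  have h1 := hCS.2 xd y x _ _ hyη hxη hyx
  have h2 := mul_le_mul_of_nonneg_left (h.pathIntegral_sub_le hvn hu hy hx) hε
  have h3 : c * r / 4 * a ≤ inputCost R ud u - inputCost R ud v := by
    have hiu := hu.integrable_wsq hud.1 R
    have hiv := hvn.integrable_wsq hud.1 R
    have h4 : ∫ s, c * r / 2 * ‖v s - u s‖ ∂(leb T) ≤
        ∫ s, (wsq R (u s - ud s) - wsq R (v s - ud s)) ∂(leb T) := by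
      refine integral_mono_ae ((hv'.sub hu').norm.const_mul _) (hiu.sub hiv) ?_
      filter_upwards [hcase] with s hs
      rcases hs with ⟨h5, h6⟩ | ⟨-, h6⟩
      · rw [h6, sub_self, wsq_zero, sub_zero, norm_sub_rev]
        refine le_trans ?_ (hR (u s - ud s))
        have := mul_le_mul_of_nonneg_right h5.le (norm_nonneg (u s - ud s))
        nlinarith
      · simp [h6]
    rw [integral_const_mul, integral_sub hiu hiv] at h4
    unfold inputCost
    linarith
  have h4 := hmin y v hvn hy
  unfold cost at h4
  simp only [← hGdef, ← hΛ, ← ha] at h2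
  have h5 : c * r / 4 * a ≤ CS * (G * d) * (G * a) + ε * (Λ * a) := by linarith
  have h6 : CS * (G * d) * (G * a) ≤ CS * (G * (2 * T / c * (ε * Λ))) * (G * a) := by
    have := hCS.1
    gcongr
  have h7 := mul_le_mul_of_nonneg_right hcε ha0
  have h8 : c * r / 8 * a ≤ 0 := by
    have e : CS * (G * (2 * T / c * (ε * Λ))) * (G * a) + ε * (Λ * a) =
        ε * (Λ * (CS * G ^ 2 * (2 * T / c) + 1)) * a := by ring
    linarith
  have ha' : a = 0 := by
    refine le_antisymm ?_ ha0
    by_contra hcon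
    have : 0 < c * r / 8 * a := mul_pos (by positivity) (not_le.1 hcon)
    linarith
  rw [ha, integral_eq_zero_iff_of_nonneg (f := fun s => ‖v s - u s‖) (fun s => norm_nonneg _) (hv'.sub hu').norm] at ha'
  filter_upwards [hcase, ha'] with s hs h9
  rcases hs with ⟨h10, h11⟩ | ⟨h10, -⟩
  · rw [h11] at h9
    simp only [Pi.zero_apply, norm_eq_zero] at h9
    rw [norm_sub_rev, h9, norm_zero]
    positivity
  · exact h10

lemma cost_lt_of_isMin (h : LocalSetting F L K x₀ φ M Lφ Kφ xd ud r) (hQ : Q.PosSemidef)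
    (hPf : Pf.PosSemidef) (hc : 0 < c) (hR : ∀ a : Vec m, c * ‖a‖ ^ 2 ≤ wsq R a)
    (hCS : IsStateCostConst h.time_pos Q Pf CS) (hε : 0 ≤ ε)
    (hcr : CS * (gronwallConst T L * L * (T * r)) *
      (gronwallConst T L * (K * sqConst T L)) ≤ c / 32)
    (hcε : ε * (Kφ * sqConst T L + Lφ * (T * (gronwallConst T L * (K * sqConst T L)))) ≤ c / 32)
    (hu : IsNear ud r u) (hx : IsSol F x₀ x u)
    (hmin : ∀ y v, IsNear ud r v → IsSol F x₀ y v →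
      cost h.time_pos Q Pf R φ ε xd ud x u ≤ cost h.time_pos Q Pf R φ ε xd ud y v)
    (hv : IsNear ud r v) (hy : IsSol F x₀ y v) (huv : ¬ u =ᵐ[leb T] v) :
    cost h.time_pos Q Pf R φ ε xd ud x u < cost h.time_pos Q Pf R φ ε xd ud y v := by
  set w : Icc (0 : ℝ) T → Vec m := fun s => (1 / 2 : ℝ) • (u s + v s) with hw
  have hwm : AEStronglyMeasurable w (leb T) := (hu.1.add hv.1).const_smul (1 / 2 : ℝ)
  have hwuv : ∀ᵐ s ∂(leb T), w s = (1 / 2 : ℝ) • (u s + v s) := .of_forall fun s => rfl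
  obtain ⟨z, hz⟩ := h.tame.exists_isSol h.time_pos x₀ hwm
  have h1 := h.cost_midpoint_le hQ hPf hR hCS hε hcr hcε hu hv hwm hwuv hx hy hz
  have h2 := hmin z w (hu.midpoint hv hwm hwuv) hz
  have h3 : 0 < ∫ s, ‖u s - v s‖ ^ 2 ∂(leb T) := by
    refine (integral_nonneg fun s => by positivity).lt_of_ne fun h0 => huv ?_
    have h0' := h0.symm
    rw [integral_eq_zero_iff_of_nonneg (fun s => by positivity) (hu.integrable_sq hv)] at h0'
    filter_upwards [h0'] with s hs
    simpa [sub_eq_zero] using hs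
  have h4 := mul_pos (by positivity : 0 < c / 16) h3
  linarith

end LocalSetting

/-! ### Curves with inputs in `L∞` -/

lemma ae_norm_le_norm_Linfty {T : ℝ} {m : ℕ} (u : Lp (Vec m) ∞ (leb T)) :
    ∀ᵐ s ∂(leb T), ‖u s‖ ≤ ‖u‖ := by
  have h : ∀ᵐ s ∂(leb T), ‖u s‖ₑ ≤ eLpNormEssSup u (leb T) := ae_le_eLpNormEssSup
  filter_upwards [h] with s hs
  have hne : eLpNormEssSup u (leb T) ≠ ∞ := by
    rw [← eLpNorm_exponent_top]
    exact Lp.eLpNorm_ne_top u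
  have := ENNReal.toReal_mono hne hs
  rwa [toReal_enorm, ← eLpNorm_exponent_top, ← Lp.norm_def] at this

lemma isNear_of_dist_le {T : ℝ} {n m : ℕ} {ξ ξ' : Curve T n m} {r : ℝ} (h : dist ξ ξ' ≤ r) :
    IsNear ξ'.2 r ξ.2 := by
  refine ⟨Lp.aestronglyMeasurable _, ?_⟩
  filter_upwards [ae_norm_le_norm_Linfty (ξ.2 - ξ'.2), Lp.coeFn_sub ξ.2 ξ'.2] with s h1 h2
  rw [h2, Pi.sub_apply, ← dist_eq_norm ξ.2] at h1
  exact h1.trans ((le_max_right _ _).trans h)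

lemma norm_state_sub_le_of_dist_le {T : ℝ} {n m : ℕ} {ξ ξ' : Curve T n m} {r : ℝ}
    (h : dist ξ ξ' ≤ r) (s : Icc (0 : ℝ) T) : ‖ξ.1 s - ξ'.1 s‖ ≤ r := by
  rw [← dist_eq_norm]
  exact (ContinuousMap.dist_apply_le_dist s).trans ((le_max_left _ _).trans h)

lemma integrable_Linfty {T : ℝ} {m : ℕ} (u : Lp (Vec m) ∞ (leb T)) : Integrable u (leb T) :=
  (Lp.memLp u).integrable le_top

lemma ae_norm_curve_le {T : ℝ} {n m : ℕ} (ξ : Curve T n m) :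
    ∀ᵐ s ∂(leb T), ‖(ξ.1 s, ξ.2 s)‖ ≤ ‖ξ‖ := by
  filter_upwards [ae_norm_le_norm_Linfty ξ.2] with s hs
  exact max_le ((ξ.1.norm_coe_le_norm s).trans (le_max_left _ _)) (hs.trans (le_max_right _ _))

lemma curveDist_eq {T : ℝ} (hT : 0 < T) {n m : ℕ} (Q Pf : Matrix (Fin n) (Fin n) ℝ)
    (R : Matrix (Fin m) (Fin m) ℝ) (ξ ξd : Curve T n m) :
    curveDist hT Q R Pf ξ ξd = stateCost hT Q Pf ξd.1 ξ.1 + inputCost R ξd.2 ξ.2 := by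
  have h := (isNear_of_dist_le le_rfl).integrable_wsq (Lp.aestronglyMeasurable ξd.2) R (u := ξ.2)
  rw [curveDist, integral_add (integrable_wsq_sub Q _ _) h, stateCost, inputCost]
  ring

lemma IsSol.congr {T : ℝ} {n m : ℕ} {F f : Vec n × Vec m → Vec n} {x₀ : Vec n}
    {x : C(Icc (0 : ℝ) T, Vec n)} {u v : Icc (0 : ℝ) T → Vec m} (hx : IsSol F x₀ x u)
    (h : ∀ᵐ s ∂(leb T), F (x s, u s) = f (x s, v s)) : IsSol f x₀ x v := fun t => by
  rw [hx t, integral_congr_ae (ae_restrict_of_ae h)]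

lemma cost_congr {T : ℝ} (hT : 0 < T) {n m : ℕ} (Q Pf : Matrix (Fin n) (Fin n) ℝ)
    (R : Matrix (Fin m) (Fin m) ℝ) (φ : Vec n × Vec m → ℝ) (ε : ℝ)
    (xd : C(Icc (0 : ℝ) T, Vec n)) (ud : Icc (0 : ℝ) T → Vec m) (x : C(Icc (0 : ℝ) T, Vec n))
    {u v : Icc (0 : ℝ) T → Vec m} (huv : u =ᵐ[leb T] v) :
    cost hT Q Pf R φ ε xd ud x u = cost hT Q Pf R φ ε xd ud x v := by
  have h1 : inputCost R ud u = inputCost R ud v := by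
    unfold inputCost
    rw [integral_congr_ae (g := fun s => wsq R (v s - ud s)) (huv.mono fun s hs => by
      simp only [hs])]
  have h2 : pathIntegral φ x u = pathIntegral φ x v :=
    integral_congr_ae (huv.mono fun s hs => by simp only [hs])
  rw [cost, cost, h1, h2]

/-- The barrier is close to its value at `ξs` near `ξs`. -/
lemma exists_barrier_le_add_one {T : ℝ} (hT : 0 < T) {n m N : ℕ} (C : ScalableRegion n m N) {k : ℕ}
    (hk : Even k) (hk2 : 2 ≤ k) {δ : ℝ} (hδ : 0 < δ) {ρ : ℝ} (hρ : ρ ∈ Icc (0 : ℝ) 1)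
    (ξs : Curve T n m) :
    ∃ r > 0, ∀ ξ, dist ξ ξs < r → barrier C k δ ρ ξ ≤ barrier C k δ ρ ξs + 1 := by
  obtain ⟨L, K, hLK⟩ := exists_isSemiconvexOnBall_barrierIntegrand C hk hk2 hδ (‖ξs‖ + 1)
  have h := hLK ρ hρ
  have hL := h.lip_nonneg
  refine ⟨min 1 (1 / (2 * L * T + 1)), by positivity, fun ξ hξ => ?_⟩
  have h1 : ‖ξ‖ ≤ ‖ξs‖ + 1 := by
    have := norm_le_norm_add_norm_sub' ξ ξs
    rw [← dist_eq_norm] at this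
    linarith [hξ.le.trans (min_le_left _ _)]
  have h2 := h.pathIntegral_sub_le hT (integrable_Linfty ξ.2) (integrable_Linfty ξs.2)
    ((ae_norm_curve_le ξ).mono fun s hs => hs.trans h1)
    ((ae_norm_curve_le ξs).mono fun s hs => hs.trans (by linarith))
    (norm_state_sub_le_of_dist_le le_rfl)
  have h3 := (isNear_of_dist_le (le_refl (dist ξ ξs))).integral_norm_sub_le hT
    (integrable_Linfty ξs.2)
  have h4 : L * (T * dist ξ ξs + ∫ s, ‖ξ.2 s - ξs.2 s‖ ∂(leb T)) ≤ 1 := by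
    have h5 := hξ.le.trans (min_le_right _ _)
    rw [le_div_iff₀ (by positivity)] at h5
    have h6 := mul_le_mul_of_nonneg_left h3 hL
    linarith [dist_nonneg (x := ξ) (y := ξs)]
  have h7 : pathIntegral (barrierIntegrand C k δ ρ) ξ.1 ξ.2 = barrier C k δ ρ ξ := rfl
  have h8 : pathIntegral (barrierIntegrand C k δ ρ) ξs.1 ξs.2 = barrier C k δ ρ ξs := rfl
  linarith

/-- The matrix of the output map. -/
def outputMatrix {n q : ℕ} (sel : Fin q ↪ Fin n) : Matrix (Fin q) (Fin n) ℝ :=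
  Matrix.of fun i j => if sel i = j then 1 else 0

lemma wsq_output {n q : ℕ} (sel : Fin q ↪ Fin n) (W : Matrix (Fin q) (Fin q) ℝ) (a : Vec n) :
    wsq W (output sel a) =
      wsq ((outputMatrix sel).transpose * W * outputMatrix sel) a := by
  have h : (outputMatrix sel).mulVec a.ofLp = (output sel a).ofLp := by
    ext i
    simp [outputMatrix, output, Matrix.mulVec, dotProduct]
  rw [wsq, wsq, ← Matrix.mulVec_mulVec, ← Matrix.mulVec_mulVec, Matrix.dotProduct_mulVec a.ofLp,
    Matrix.vecMul_transpose, h]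

lemma outputNorm_eq {T : ℝ} (hT : 0 < T) {n q : ℕ} (sel : Fin q ↪ Fin n)
    (W W₁ : Matrix (Fin q) (Fin q) ℝ) (xd x : C(Icc (0 : ℝ) T, Vec n)) :
    outputNorm hT W W₁ (fun t => output sel (x t) - output sel (xd t)) =
      2 * stateCost hT ((outputMatrix sel).transpose * W * outputMatrix sel)
        ((outputMatrix sel).transpose * W₁ * outputMatrix sel) xd x := by
  have h : ∀ t, output sel (x t) - output sel (xd t) = output sel (x t - xd t) := fun t => by
    ext i
    simp [output]
  simp only [outputNorm, stateCost, h, wsq_output]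
  ring

lemma exists_outputNorm_le_add_one {T : ℝ} (hT : 0 < T) {n m q : ℕ} (sel : Fin q ↪ Fin n)
    (W W₁ : Matrix (Fin q) (Fin q) ℝ) (ξd ξs : Curve T n m) :
    ∃ r > 0, ∀ ξ : Curve T n m, dist ξ ξs < r →
      outputNorm hT W W₁ (fun t => output sel (ξs.1 t) - output sel (ξd.1 t)) ≤
        outputNorm hT W W₁ (fun t => output sel (ξ.1 t) - output sel (ξd.1 t)) + 1 := by
  simp_rw [outputNorm_eq]
  obtain ⟨C, hC0, hC⟩ := exists_isStateCostConst hT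
    ((outputMatrix sel).transpose * W * outputMatrix sel)
    ((outputMatrix sel).transpose * W₁ * outputMatrix sel)
  set η := dist ξs ξd + 1 with hη
  have hη0 : 0 < η := by positivity
  refine ⟨min 1 (1 / (2 * (C * η) + 1)), by positivity, fun ξ hξ => ?_⟩
  have h1 : dist ξ ξd ≤ η := by
    have := dist_triangle ξ ξs ξd
    linarith [hξ.le.trans (min_le_left _ _)]
  have h2 := hC ξd.1 ξs.1 ξ.1 η (dist ξ ξs)
    (norm_state_sub_le_of_dist_le (by linarith)) (norm_state_sub_le_of_dist_le h1)
    (norm_state_sub_le_of_dist_le (dist_comm ξs ξ).le)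
  have h5 := hξ.le.trans (min_le_right _ _)
  rw [le_div_iff₀ (by positivity)] at h5
  linarith [dist_nonneg (x := ξ) (y := ξs)]

/-! ### Existence of isolated local minimizers -/

lemma exists_isIsolatedLocalMin {n m N : ℕ} {T : ℝ} (hT : 0 < T)
    {f : Vec n × Vec m → Vec n} (hf : ContDiff ℝ 2 f) {x₀ : Vec n}
    {Q Pf : Matrix (Fin n) (Fin n) ℝ} {R : Matrix (Fin m) (Fin m) ℝ}
    (hQ : Q.PosDef) (hR : R.PosDef) (hPf : Pf.PosDef)
    {k : ℕ} (hk : Even k) (hk2 : 2 ≤ k) {ξd : Curve T n m} (hξd : ξd ∈ trajectories f x₀)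
    (C : ScalableRegion n m N) {δ : ℝ} (hδ : 0 < δ) :
    ∃ ε₀ : ℝ, 0 < ε₀ ∧ ∀ ρ ∈ Icc (0 : ℝ) 1, ∀ ε : ℝ, 0 ≤ ε → ε < ε₀ →
      ∃ ξ : Curve T n m, IsIsolatedLocalMin
        (fun ξ => curveDist hT Q R Pf ξ ξd + ε * barrier C k δ ρ ξ) (trajectories f x₀) ξ := by
  set M := ‖ξd‖ + 1 with hM
  obtain ⟨F, L, K, hF, hFf⟩ := exists_isTame_eq_on_ball hf M
  obtain ⟨Lφ, Kφ, hφ⟩ := exists_isSemiconvexOnBall_barrierIntegrand C hk hk2 hδ M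
  obtain ⟨c, hc, hcR⟩ := exists_le_wsq hR
  obtain ⟨CS, hCS⟩ := exists_isStateCostConst hT Q Pf
  have hL := hF.lip_nonneg
  have hK := hF.mid_nonneg
  have hLφ := (hφ 0 ⟨le_rfl, zero_le_one⟩).lip_nonneg
  have hKφ := (hφ 0 ⟨le_rfl, zero_le_one⟩).mid_nonneg
  have hCS0 := hCS.1
  have hΓ := gronwallConst_pos T L
  have hsq := sqConst_pos T L
  set G := gronwallConst T L * L with hG
  have hG0 : 0 ≤ G := by positivity
  set G₂ := gronwallConst T L * (K * sqConst T L) with hG₂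
  have hG₂0 : 0 ≤ G₂ := by positivity
  have hsmall : ∀ a b : ℝ, 0 < a → 0 ≤ b → ∀ t, t ≤ a / (b + 1) → t * b ≤ a :=
    fun a b ha hb t ht => by
      rcases le_or_gt t 0 with h | h
      · nlinarith
      · rw [le_div_iff₀ (by positivity)] at ht
        linarith
  -- first the radius, then the weight of the barrier
  set r := min (1 / (G * T + 1)) (c / 32 / (CS * G * T * G₂ + 1)) with hr
  have hr0 : 0 < r := by positivity
  set A := Kφ * sqConst T L + Lφ * (T * G₂) with hA
  set B := Lφ * (T * G + 1) * (CS * G ^ 2 * (2 * T / c) + 1) with hB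
  have hA0 : 0 ≤ A := by positivity
  have hB0 : 0 ≤ B := by positivity
  refine ⟨min (c / 32 / (A + 1)) (c * r / 8 / (B + 1)), by positivity, fun ρ hρ ε hε hε₀ => ?_⟩
  have hcr : CS * (G * (T * r)) * G₂ ≤ c / 32 := by
    have := hsmall (c / 32) (CS * G * T * G₂) (by positivity) (by positivity) r (min_le_right _ _)
    linarith
  have hcε := hsmall (c / 32) A (by positivity) hA0 ε (hε₀.le.trans (min_le_left _ _))
  have hcε' := hsmall (c * r / 8) B (by positivity) hB0 ε (hε₀.le.trans (min_le_right _ _))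
  have hrle : (G * T + 1) * r ≤ 1 := by
    have := min_le_left (1 / (G * T + 1)) (c / 32 / (CS * G * T * G₂ + 1))
    rw [← hr, le_div_iff₀ (by positivity)] at this
    linarith
  have hGTr : 0 ≤ G * T * r := by positivity
  have hS : LocalSetting F L K x₀ (barrierIntegrand C k δ ρ) M Lφ Kφ ξd.1 ξd.2 r :=
    { time_pos := hT
      tame := hF
      semiconvex := hφ ρ hρ
      isSol := IsSol.congr (F := f) hξd (by
        filter_upwards [ae_norm_curve_le ξd] with s hs
        rw [hFf _ (hs.trans (by linarith))])
      integrable := integrable_Linfty ξd.2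
      state_le := fun s => add_le_add_left ((ξd.1.norm_coe_le_norm s).trans (le_max_left _ _)) 1
      input_le := (ae_norm_le_norm_Linfty ξd.2).mono fun s hs =>
        add_le_add_left (hs.trans (le_max_right _ _)) 1
      radius_pos := hr0
      radius_le := hrle }
  obtain ⟨x, u, hu, hx, hmin⟩ := hS.exists_minimizer hQ.posSemidef hPf.posSemidef hc hcR hCS hε
    hcr hcε
  have hhalf := hS.norm_sub_le_half_of_isMin hQ.posSemidef hPf.posSemidef hc hcR hCS hε hcε' hu hx
    hmin
  have hutop : MemLp u ∞ (leb T) := memLp_top_of_bound hu.1 M (by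
    filter_upwards [hS.norm_le hu hx] with s hs using (le_max_right _ _).trans hs)
  -- the candidate is the curve of the minimizer, with its input regarded as an element of `L∞`
  set ξ : Curve T n m := (x, hutop.toLp u) with hξ
  have hξu : ξ.2 =ᵐ[leb T] u := hutop.coeFn_toLp
  have hξn : IsNear ξd.2 r ξ.2 := ⟨Lp.aestronglyMeasurable _, by
    filter_upwards [hξu, hu.2] with s h1 h2
    rwa [h1]⟩
  have hξs : IsSol F x₀ ξ.1 ξ.2 := hx.congr (hξu.mono fun s hs => by rw [hs])
  have hξmin : ∀ y v, IsNear ξd.2 r v → IsSol F x₀ y v →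
      cost hS.time_pos Q Pf R (barrierIntegrand C k δ ρ) ε ξd.1 ξd.2 ξ.1 ξ.2 ≤
        cost hS.time_pos Q Pf R (barrierIntegrand C k δ ρ) ε ξd.1 ξd.2 y v := fun y v hv hy =>
    (cost_congr hT Q Pf R _ ε _ _ x hξu).le.trans (hmin y v hv hy)
  have hcost : ∀ ζ : Curve T n m, curveDist hT Q R Pf ζ ξd + ε * barrier C k δ ρ ζ =
      cost hT Q Pf R (barrierIntegrand C k δ ρ) ε ξd.1 ξd.2 ζ.1 ζ.2 := fun ζ => by
    rw [curveDist_eq]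
    rfl
  refine ⟨ξ, hξs.congr ?_, r / 2, by positivity, fun ζ hζ hdist hne => ?_⟩
  · filter_upwards [hS.norm_le hξn hξs] with s hs using hFf _ hs
  -- near the candidate, trajectories of `f` are trajectories of the tame field
  have hζn : IsNear ξd.2 r ζ.2 := ⟨Lp.aestronglyMeasurable _, by
    filter_upwards [(isNear_of_dist_le hdist.le).2, hξu, hhalf] with s h1 h2 h3
    have := norm_sub_le_norm_sub_add_norm_sub (ζ.2 s) (ξ.2 s) (ξd.2 s)
    rw [h2] at this h1
    linarith⟩
  have hζM : ∀ᵐ s ∂(leb T), ‖(ζ.1 s, ζ.2 s)‖ ≤ M := by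
    filter_upwards [hζn.2, hS.input_le] with s h1 h2
    rw [Prod.norm_mk]
    refine max_le ?_ ?_
    · have h3 := norm_state_sub_le_of_dist_le hdist.le s
      have h4 := hS.norm_state_sub_le hξn hξs s
      have h5 := norm_sub_le_norm_sub_add_norm_sub (ζ.1 s) (ξ.1 s) (ξd.1 s)
      have h6 := norm_le_norm_add_norm_sub' (ζ.1 s) (ξd.1 s)
      have h7 := hS.state_le s
      rw [← hG] at h4
      linarith
    · have := norm_le_norm_add_norm_sub' (ζ.2 s) (ξd.2 s)
      linarith
  have hζs : IsSol F x₀ ζ.1 ζ.2 := IsSol.congr (F := f) hζ (hζM.mono fun s hs => (hFf _ hs).symm)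
  simp only [hcost]
  refine hS.cost_lt_of_isMin hQ.posSemidef hPf.posSemidef hc hcR hCS hε hcr hcε hξn hξs hξmin hζn
    hζs fun hcon => hne ?_
  refine Prod.ext ?_ (Lp.ext hcon.symm)
  exact hF.isSol_unique hT hζs hξs (integrable_Linfty _) (integrable_Linfty _) hcon.symm

end FeasTraj

end

theorem mainTheorem4 {n m q N : ℕ} {T : ℝ} (hT : 0 < T)
    (f : FeasTraj.Vec n × FeasTraj.Vec m → FeasTraj.Vec n) (hf : ContDiff ℝ 2 f)
    (x₀ : FeasTraj.Vec n) (sel : Fin q ↪ Fin n)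
    (Q Pf : Matrix (Fin n) (Fin n) ℝ) (R : Matrix (Fin m) (Fin m) ℝ)
    (hQ : Q.PosDef) (hR : R.PosDef) (hPf : Pf.PosDef)
    (W W₁ : Matrix (Fin q) (Fin q) ℝ) (hW : W.PosDef) (hW₁ : W₁.PosSemidef)
    (k : ℕ) (hk : Even k) (hk2 : 2 ≤ k)
    (yd : Set.Icc (0 : ℝ) T → FeasTraj.Vec q)
    (ξd : FeasTraj.Curve T n m) (hξd : ξd ∈ FeasTraj.trajectories f x₀)
    (hlift : ∀ t, FeasTraj.output sel (ξd.1 t) = yd t)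
    (C : FeasTraj.ScalableRegion n m N) (hcompact : IsCompact (C.region 1))
    (hcontain : ∃ ρ₁ ∈ Set.Icc (0 : ℝ) 1,
      ∀ᵐ t ∂(FeasTraj.leb T), (ξd.1 t, ξd.2 t) ∈ interior (C.region ρ₁))
    (δc : ℝ) (hδc : 0 < δc) :
    -- (i) existence of isolated local minimizers
    (∃ ρ₀ : ℝ, 0 < ρ₀ ∧ ρ₀ ≤ 1 ∧ ∃ εc₀ : ℝ, 0 < εc₀ ∧
      ∀ ρ εc : ℝ, 0 ≤ ρ → ρ < ρ₀ → 0 ≤ εc → εc < εc₀ →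
        ∃ ξ : FeasTraj.Curve T n m,
          FeasTraj.IsIsolatedLocalMin
            (fun ξ => FeasTraj.curveDist hT Q R Pf ξ ξd + εc * FeasTraj.barrier C k δc ρ ξ)
            (FeasTraj.trajectories f x₀) ξ) ∧
    (∀ ρ εc : ℝ, 0 < ρ → ρ ≤ 1 → 0 < εc → ∀ ξs : FeasTraj.Curve T n m,
      FeasTraj.IsIsolatedLocalMin
        (fun ξ => FeasTraj.curveDist hT Q R Pf ξ ξd + εc * FeasTraj.barrier C k δc ρ ξ)
        (FeasTraj.trajectories f x₀) ξs →
      -- (ii) local suboptimality for the distance to `ξd`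
      (∃ ε₂ : ℝ, 0 < ε₂ ∧ ∃ V ∈ nhds ξs, ∀ ξ ∈ V ∩ FeasTraj.trajectories f x₀,
        FeasTraj.curveDist hT Q R Pf ξs ξd ≤ FeasTraj.curveDist hT Q R Pf ξ ξd + ε₂) ∧
      -- (iii) local suboptimality for the output error
      (∃ ε₃ : ℝ, 0 < ε₃ ∧ ∃ V ∈ nhds ξs, ∀ ξ ∈ V ∩ FeasTraj.trajectories f x₀,
        FeasTraj.outputNorm hT W W₁ (fun t => FeasTraj.output sel (ξs.1 t) - yd t) ≤
          FeasTraj.outputNorm hT W W₁ (fun t => FeasTraj.output sel (ξ.1 t) - yd t) + ε₃)) := by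
  refine ⟨?_, fun ρ εc hρ hρ1 hεc ξs hξs => ⟨?_, ?_⟩⟩
  · obtain ⟨ε₀, hε₀, h⟩ :=
      FeasTraj.exists_isIsolatedLocalMin hT hf hQ hR hPf hk hk2 hξd C hδc
    exact ⟨1, one_pos, le_rfl, ε₀, hε₀, fun ρ εc h1 h2 h3 h4 => h ρ ⟨h1, h2.le⟩ εc h3 h4⟩
  · -- near `ξs` the barrier varies by at most `1`, hence its multiple in the cost by at most `εc`
    obtain ⟨-, r₁, hr₁, hloc⟩ := hξs
    obtain ⟨r₂, hr₂, hbar⟩ :=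
      FeasTraj.exists_barrier_le_add_one hT C hk hk2 hδc ⟨hρ.le, hρ1⟩ ξs
    refine ⟨εc, hεc, Metric.ball ξs (min r₁ r₂), Metric.ball_mem_nhds _ (lt_min hr₁ hr₂),
      fun ξ hξ => ?_⟩
    obtain ⟨hξb, hξT⟩ := hξ
    rw [Metric.mem_ball] at hξb
    rcases eq_or_ne ξ ξs with rfl | hne
    · linarith
    have h1 := hloc ξ hξT (hξb.trans_le (min_le_left _ _)) hne
    have h2 := mul_le_mul_of_nonneg_left (hbar ξ (hξb.trans_le (min_le_right _ _))) hεc.le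
    simp only at h1
    linarith
  · obtain ⟨r, hr, h⟩ := FeasTraj.exists_outputNorm_le_add_one hT sel W W₁ ξd ξs
    simp only [hlift] at h
    exact ⟨1, one_pos, Metric.ball ξs r, Metric.ball_mem_nhds _ hr,
      fun ξ hξ => h ξ (Metric.mem_ball.1 hξ.1)⟩
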